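/- Let $I=(\alpha,\beta)$ with $-\infty<\alpha<\beta<\infty$, let $x_0\in[\alpha,\beta]$, and let $a$ be a proper impedance on $I$, that is, a positive measurable function with $a,\frac1a\in L^2(I)$. The formal powers associated with $a$ and centered at $x_0$ are the functions \[ \varphi_a^{(0)}\equiv 1,\qquad \varphi_a^{(1)}(x)=\int_{x_0}^x\frac{dt}{a^2(t)},\qquad \varphi_a^{(k)}(x)=k(k-1)\int_{x_0}^x\frac{1}{a^2(t)}\int_{x_0}^t a^2(s)\,\varphi_a^{(k-2)}(s)\,ds\,dt\quad(k\ge 2). \] A sequence in a complex Banach space $X$ is called a complete system in $X$ if its linear span over $\mathbb C$ is dense in $X$. Let $1\le p<\infty$, and let $W^{m,p}(I)$ be the Sobolev space of complex-valued functions that lie in $L^p(I)$ together with their weak derivatives of order at most $m$. (i) If $a,\frac1a\in L^\infty(I)$, then the formal powers $\{\varphi_a^{(k)}\}_{k=0}^\infty$ belong to $W^{1,p}(I)$ and are a complete system in $W^{1,p}(I)$. (ii) Let $m\ge 2$ be an integer and let $a\in W^{m-1,p}(I)$; in the case $m=2$ and $p<2$, assume in addition that $\frac1a\in L^\infty(I)$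 (in all other cases this follows from the other hypotheses). Then the formal powers $\{\varphi_a^{(k)}\}_{k=0}^\infty$ belong to $W^{m,p}(I)$ and are a complete system in $W^{m,p}(I)$. -/

import Mathlib

open MeasureTheory Set
open scoped ENNReal ContDiff

noncomputable section

/-- `v` is the weak (distributional) derivative of order `k` of `u` on the open interval `(α, β)`. -/
def IsWeakDeriv {E : Type*} [NormedAddCommGroup E] [NormedSpace ℝ E]
    (α β : ℝ) (k : ℕ) (u v : ℝ → E) : Prop :=
  ∀ φ : ℝ → ℝ, ContDiff ℝ ∞ φ → HasCompactSupport φ → tsupport φ ⊆ Ioo α β →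
    ∫ x in Ioo α β, iteratedDeriv k φ x • u x = (-1 : ℝ) ^ k • ∫ x in Ioo α β, φ x • v x

/-- The function `u` belongs to the Sobolev class `W^{m,p}(α, β)`: it lies in `L^p` together with
its weak derivatives of order `1, …, m`. -/
def MemSobolev {E : Type*} [NormedAddCommGroup E] [NormedSpace ℝ E]
    (α β : ℝ) (m : ℕ) (p : ℝ≥0∞) (u : ℝ → E) : Prop :=
  MemLp u p (volume.restrict (Ioo α β)) ∧
    ∀ k, 1 ≤ k → k ≤ m →
      ∃ v : ℝ → E, MemLp v p (volume.restrict (Ioo α β)) ∧ IsWeakDeriv α β k u v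

/-- A smooth compactly supported function times an `L^p` function is integrable on `(α, β)`. -/
lemma integrable_iteratedDeriv_smul {α β : ℝ} {p : ℝ≥0∞} [Fact (1 ≤ p)] (k : ℕ)
    {φ : ℝ → ℝ} (hφ : ContDiff ℝ ∞ φ) (hc : HasCompactSupport φ)
    (u : Lp ℂ p (volume.restrict (Ioo α β))) :
    Integrable (fun x => iteratedDeriv k φ x • u x) (volume.restrict (Ioo α β)) := by
  have hcont : Continuous (iteratedDeriv k φ) := hφ.continuous_iteratedDeriv k (by exact_mod_cast le_top)
  have hsupp : HasCompactSupport (iteratedDeriv k φ) := by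
    have h := hc.iteratedFDeriv (𝕜 := ℝ) k
    rw [iteratedDeriv_eq_equiv_comp]
    exact h.comp_left (map_zero _)
  obtain ⟨C, hC⟩ := hsupp.exists_bound_of_continuous hcont
  have hu : Integrable (u : ℝ → ℂ) (volume.restrict (Ioo α β)) :=
    (Lp.memLp u).integrable Fact.out
  exact hu.bdd_smul C hcont.aestronglyMeasurable (Filter.Eventually.of_forall hC)

/-- The complex Sobolev space `W^{m,p}(α, β)`. A function `u` is represented by the tuple
`(u, u', …, u^{(m)})` of its weak derivatives in `L^p`; the entry `0` determines the others. The
norm is `max_k ‖u^{(k)}‖_{L^p}`, one of the usual equivalent norms. -/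
def sobolevSpace (α β : ℝ) (m : ℕ) (p : ℝ≥0∞) [Fact (1 ≤ p)] :
    Submodule ℂ (Fin (m + 1) → Lp ℂ p (volume.restrict (Ioo α β))) where
  carrier := {U | ∀ k : Fin (m + 1), IsWeakDeriv α β (k : ℕ) (U 0) (U k)}
  zero_mem' := by
    intro k φ _ _ _
    have h : (((0 : Lp ℂ p (volume.restrict (Ioo α β)))) : ℝ → ℂ)
        =ᵐ[volume.restrict (Ioo α β)] 0 := Lp.coeFn_zero _ _ _
    have h1 : ∀ g : ℝ → ℝ, ∫ x in Ioo α β,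
        g x • (0 : Lp ℂ p (volume.restrict (Ioo α β))) x = 0 := by
      intro g
      rw [integral_eq_zero_of_ae]
      filter_upwards [h] with x hx
      rw [hx]; simp
    simp only [Pi.zero_apply]
    rw [h1, h1, smul_zero]
  add_mem' := by
    intro U V hU hV k φ hφ hc hs
    have key : ∀ (j : ℕ) (u v : Lp ℂ p (volume.restrict (Ioo α β))),
        ∫ x in Ioo α β, iteratedDeriv j φ x • (u + v) x
          = (∫ x in Ioo α β, iteratedDeriv j φ x • u x)
            + ∫ x in Ioo α β, iteratedDeriv j φ x • v x := by
      intro j u v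
      rw [← integral_add (integrable_iteratedDeriv_smul j hφ hc u)
        (integrable_iteratedDeriv_smul j hφ hc v)]
      apply integral_congr_ae
      filter_upwards [Lp.coeFn_add u v] with x hx
      rw [hx, Pi.add_apply, smul_add]
    have k0 := key 0 (U k) (V k)
    simp only [iteratedDeriv_zero] at k0
    simp only [Pi.add_apply]
    rw [key, k0, hU k φ hφ hc hs, hV k φ hφ hc hs, smul_add]
  smul_mem' := by
    intro c U hU k φ hφ hc hs
    have key : ∀ (g : ℝ → ℝ) (u : Lp ℂ p (volume.restrict (Ioo α β))),
        ∫ x in Ioo α β, g x • (c • u) x = c • ∫ x in Ioo α β, g x • u x := by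
      intro g u
      rw [← integral_smul]
      apply integral_congr_ae
      filter_upwards [Lp.coeFn_smul c u] with x hx
      rw [hx, Pi.smul_apply, smul_comm]
    simp only [Pi.smul_apply]
    rw [key, key, hU k φ hφ hc hs, smul_comm]

/-- A sequence in a complex normed space is a complete system if its span is dense. -/
def IsCompleteSystem {X : Type*} [NormedAddCommGroup X] [NormedSpace ℂ X] (f : ℕ → X) : Prop :=
  Dense (Submodule.span ℂ (range f) : Set X)

/-- The functions `f 0, f 1, …` belong to `W^{m,p}(α, β)` and form a complete system there. -/
def IsCompleteInSobolev (α β : ℝ) (m : ℕ) (p : ℝ≥0∞) [Fact (1 ≤ p)] (f : ℕ → ℝ → ℂ) : Prop :=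
  ∃ F : ℕ → sobolevSpace α β m p,
    (∀ k, ((F k : Fin (m + 1) → Lp ℂ p (volume.restrict (Ioo α β))) 0 : ℝ → ℂ)
      =ᵐ[volume.restrict (Ioo α β)] f k) ∧
    IsCompleteSystem F

/-- A proper impedance on `(α, β)`: a positive function `a` with `a, 1/a ∈ L²`. -/
structure IsProperImpedance (α β : ℝ) (a : ℝ → ℝ) : Prop where
  pos : ∀ᵐ x ∂volume.restrict (Ioo α β), 0 < a x
  memLp : MemLp a 2 (volume.restrict (Ioo α β))
  memLp_inv : MemLp (fun x => 1 / a x) 2 (volume.restrict (Ioo α β))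

/-- The formal powers associated with `a`, centered at `x₀`. -/
def formalPower (a : ℝ → ℝ) (x₀ : ℝ) : ℕ → ℝ → ℝ
  | 0 => fun _ => 1
  | 1 => fun x => ∫ t in x₀..x, 1 / a t ^ 2
  | k + 2 => fun x => ((k : ℝ) + 2) * ((k : ℝ) + 1) *
      ∫ t in x₀..x, 1 / a t ^ 2 * ∫ s in x₀..t, a s ^ 2 * formalPower a x₀ k s

end

/-!
# Completeness of formal powers in Sobolev spaces

Write `w = a²` and `q = 1 / a²`. Up to constants, the derivative of a formal power of `a` is `q`
times a formal power of the reciprocal impedance `1 / a` (`formalPower_succ`). Hence, if `w` and `q`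
are multipliers of `W^{m,p}`, approximating `u` in `W^{m+1,p}` by formal powers of `a` amounts to
approximating `w u'` in `W^{m,p}` by formal powers of `1 / a`; the constant is supplied by the formal
power of order `0` (`FormalPowersDense.succ`). Everything descends in this way to completeness in
`L^p`. The multiplier property comes from boundedness when `m = 0`, and from the product rule
(`SobolevBound.exists_mul`) and the reciprocal rule (`SobolevBound.exists_inv`) when `a` is a Sobolev
function. If `a` has a square integrable derivative, then it has no zeros, since `1 / a²` is
integrable (`IsProperImpedance.exists_norm_inv_le`).

Completeness in `L^p` follows from the case `p = 2`: one descent step from `W^{1,2}` gives uniform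
approximation of smooth functions (`formalPowersDense_zero`). In `L²` it suffices that an integrable
`g` with `∫ g φ = 0` for all formal powers `φ` vanishes (`ae_eq_zero_of_annihilates_formalPower`).
Let `J` be the Volterra operator `J f(x) = ∫_{x₀}^x q(t) ∫_{x₀}^t w f`, which maps the span of the
formal powers to itself, and let `T f(x) = ∫_α^x q(t) ∫_t^β w f`, which is the inverse of a
Sturm–Liouville operator: it is injective, self-adjoint and nonnegative in `L²(w)`. Since `T + J`
takes values in the span of the first two formal powers, `T` leaves the orthogonal complement of the
formal powers invariant and coincides there, modulo that span, with `-J`. As `J` is quasi-nilpotent,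
the energies `d n = ‖Tⁿ f‖²` of an element `f` of that complement decay superexponentially, whereas
self-adjointness makes `n ↦ lⁿ d n` convex for every `l > 0`. Both are compatible only if some
`Tⁿ f` vanishes, so `f = 0` by injectivity.

Finally, a function with an integrable weak derivative is a primitive of it almost everywhere
(`IsWeakDeriv.exists_isPrimitiveOn`), so the Sobolev space can be handled through iterated
primitives.
-/

open scoped Interval NNReal

/-! ### Primitives of integrable functions -/

/-- On `[α, β]` the function `u` is a primitive of the integrable function `v`. Such `u` are the
absolutely continuous functions on `[α, β]` with derivative `v`; values of `u` outside the interval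
are irrelevant. -/
def IsPrimitiveOn {E : Type*} [NormedAddCommGroup E] [NormedSpace ℝ E]
    (α β : ℝ) (u v : ℝ → E) : Prop :=
  IntervalIntegrable v volume α β ∧ ∀ x ∈ Icc α β, u x = u α + ∫ t in α..x, v t

section Primitive

variable {E : Type*} [NormedAddCommGroup E] {α β : ℝ}

lemma IntervalIntegrable.subinterval {f : ℝ → E} (hf : IntervalIntegrable f volume α β)
    {x y : ℝ} (hx : x ∈ Icc α β) (hy : y ∈ Icc α β) : IntervalIntegrable f volume x y :=
  hf.mono_set (uIcc_subset_uIcc (Icc_subset_uIcc hx) (Icc_subset_uIcc hy))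

lemma intervalIntegrable_iff_integrable_Ioo (h : α ≤ β) {f : ℝ → E} :
    IntervalIntegrable f volume α β ↔ Integrable f (volume.restrict (Ioo α β)) := by
  rw [intervalIntegrable_iff_integrableOn_Ioo_of_le h, IntegrableOn]

variable [NormedSpace ℝ E]

lemma intervalIntegral_eq_integral_Ioo (h : α ≤ β) (f : ℝ → E) :
    ∫ x in α..β, f x = ∫ x in Ioo α β, f x := by
  rw [intervalIntegral.integral_of_le h, integral_Ioc_eq_integral_Ioo]

/-- Interval integrals inside `[α, β]` only see the class of the integrand almost everywhere on
`(α, β)`. -/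
lemma intervalIntegral_congr_Ioo {f g : ℝ → E} (hfg : f =ᵐ[volume.restrict (Ioo α β)] g)
    {x y : ℝ} (hx : x ∈ Icc α β) (hy : y ∈ Icc α β) : ∫ t in x..y, f t = ∫ t in x..y, g t := by
  apply intervalIntegral.integral_congr_ae
  rw [Filter.EventuallyEq, ae_restrict_iff' measurableSet_Ioo] at hfg
  filter_upwards [hfg, Measure.ae_ne volume α, Measure.ae_ne volume β] with t ht h1 h2 h3
  have h4 := uIoc_subset_uIcc h3
  have h5 : t ∈ Icc α β := by
    have := uIcc_subset_Icc hx hy h4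
    exact this
  exact ht ⟨lt_of_le_of_ne h5.1 (Ne.symm h1), lt_of_le_of_ne h5.2 h2⟩

lemma ae_Ioo_of_ae_Icc {P : ℝ → Prop} (h : ∀ x ∈ Icc α β, P x) :
    ∀ᵐ x ∂volume.restrict (Ioo α β), P x :=
  (ae_restrict_mem measurableSet_Ioo).mono fun x hx => h x (Ioo_subset_Icc_self hx)

lemma IntervalIntegrable.mul_continuousOn_Icc {𝕜 : Type*} [RCLike 𝕜] (h : α ≤ β)
    {f g : ℝ → 𝕜} (hf : IntervalIntegrable f volume α β) (hg : ContinuousOn g (Icc α β)) :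
    IntervalIntegrable (fun x => f x * g x) volume α β :=
  hf.mul_continuousOn (by rwa [uIcc_of_le h])

namespace IsPrimitiveOn

variable {u v u₁ v₁ : ℝ → E}

lemma of_integral (h : α ≤ β) (hv : IntervalIntegrable v volume α β) {c : ℝ}
    (hc : c ∈ Icc α β) (d : E) : IsPrimitiveOn α β (fun x => d + ∫ t in c..x, v t) v := by
  refine ⟨hv, fun x hx => ?_⟩
  have hα : α ∈ Icc α β := left_mem_Icc.2 h
  rw [add_assoc, intervalIntegral.integral_add_adjacent_intervals (hv.subinterval hc hα)
    (hv.subinterval hα hx)]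

lemma of_integral' (h : α ≤ β) (hv : IntervalIntegrable v volume α β) {c : ℝ}
    (hc : c ∈ Icc α β) : IsPrimitiveOn α β (fun x => ∫ t in c..x, v t) v := by
  simpa using of_integral h hv hc 0

lemma integral_eq (hu : IsPrimitiveOn α β u v) {x y : ℝ} (hx : x ∈ Icc α β)
    (hy : y ∈ Icc α β) : ∫ t in x..y, v t = u y - u x := by
  have hα : α ∈ Icc α β := left_mem_Icc.2 (hx.1.trans hx.2)
  rw [hu.2 y hy, hu.2 x hx, ← intervalIntegral.integral_interval_sub_left
    (hu.1.subinterval hα hy) (hu.1.subinterval hα hx)]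
  abel

lemma eq_add (hu : IsPrimitiveOn α β u v) {x y : ℝ} (hx : x ∈ Icc α β)
    (hy : y ∈ Icc α β) : u y = u x + ∫ t in x..y, v t := by
  rw [hu.integral_eq hx hy]; abel

lemma congr (hu : IsPrimitiveOn α β u v) (h1 : ∀ x ∈ Icc α β, u₁ x = u x)
    (h2 : v₁ =ᵐ[volume.restrict (Ioo α β)] v) (h : α ≤ β) : IsPrimitiveOn α β u₁ v₁ := by
  have hα : α ∈ Icc α β := left_mem_Icc.2 h
  refine ⟨?_, fun x hx => ?_⟩
  · rw [intervalIntegrable_iff_integrable_Ioo h]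
    exact ((intervalIntegrable_iff_integrable_Ioo h).1 hu.1).congr h2.symm
  · rw [h1 x hx, h1 α hα, intervalIntegral_congr_Ioo h2 hα hx]
    exact hu.2 x hx

/-- A primitive with prescribed value at the right end point. -/
lemma of_integral_right (h : α ≤ β) (hv : IntervalIntegrable v volume α β) :
    IsPrimitiveOn α β (fun x => ∫ t in x..β, v t) (fun t => - v t) := by
  have := of_integral' h hv.neg (right_mem_Icc.2 h)
  refine this.congr (fun x _ => ?_) (Filter.Eventually.of_forall fun _ => rfl) h
  rw [intervalIntegral.integral_symm, ← intervalIntegral.integral_neg]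
  rfl

lemma continuousOn (hu : IsPrimitiveOn α β u v) : ContinuousOn u (Icc α β) := by
  rcases le_or_gt α β with h | h
  · have h1 := intervalIntegral.continuousOn_primitive_interval' hu.1 left_mem_uIcc
    rw [uIcc_of_le h] at h1
    exact (continuousOn_const.add h1).congr hu.2
  · simp [Icc_eq_empty_of_lt h]

lemma ae_hasDerivAt [CompleteSpace E] (hu : IsPrimitiveOn α β u v) :
    ∀ᵐ x, x ∈ Ioo α β → HasDerivAt u (v x) x := by
  rcases le_or_gt α β with h | h
  · filter_upwards [hu.1.ae_hasDerivAt_integral] with x hx hx'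
    have h1 := hx (Icc_subset_uIcc (Ioo_subset_Icc_self hx')) α left_mem_uIcc
    refine (h1.const_add (u α)).congr_of_eventuallyEq ?_
    filter_upwards [Ioo_mem_nhds hx'.1 hx'.2] with y hy
    exact hu.2 y (Ioo_subset_Icc_self hy)
  · simp [Ioo_eq_empty_of_le h.le]

lemma absolutelyContinuous (h : α ≤ β) (hu : IsPrimitiveOn α β u v) :
    AbsolutelyContinuousOnInterval u α β := by
  have h1 := hu.1.norm.absolutelyContinuousOnInterval_intervalIntegral (c := α) left_mem_uIcc
  rw [absolutelyContinuousOnInterval_iff] at h1 ⊢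
  intro ε hε
  obtain ⟨δ, hδ, H⟩ := h1 ε hε
  refine ⟨δ, hδ, fun D hD hs => lt_of_le_of_lt (Finset.sum_le_sum fun i hi => ?_) (H D hD hs)⟩
  have hm := hD.1 i hi
  rw [uIcc_of_le h] at hm
  have hα : α ∈ Icc α β := left_mem_Icc.2 h
  rw [dist_eq_norm, ← hu.integral_eq hm.2 hm.1, Real.dist_eq,
    intervalIntegral.integral_interval_sub_left (hu.1.norm.subinterval hα hm.1)
      (hu.1.norm.subinterval hα hm.2)]
  exact intervalIntegral.norm_integral_le_abs_integral_norm

/-- The fundamental theorem of calculus for absolutely continuous functions. -/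
lemma of_absolutelyContinuous [CompleteSpace E] (h : α ≤ β) (hu : AbsolutelyContinuousOnInterval u α β)
    (hv : IntervalIntegrable v volume α β)
    (hd : ∀ᵐ x, x ∈ Ioo α β → HasDerivAt u (v x) x) : IsPrimitiveOn α β u v := by
  have hα : α ∈ Icc α β := left_mem_Icc.2 h
  have hP := of_integral' h hv hα
  have hac := hu.sub (hP.absolutelyContinuous h)
  obtain ⟨C, hC⟩ := hac.const_of_ae_hasDerivAt_zero (by
    filter_upwards [hd, hP.ae_hasDerivAt, Measure.ae_ne volume α, Measure.ae_ne volume β]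
      with x h1 h2 h3 h4 h5
    rw [uIcc_of_le h] at h5
    have h6 : x ∈ Ioo α β :=
      ⟨lt_of_le_of_ne h5.1 (Ne.symm h3), lt_of_le_of_ne h5.2 h4⟩
    simpa using (h1 h6).sub (h2 h6))
  refine ⟨hv, fun x hx => ?_⟩
  have e1 := hC x (Icc_subset_uIcc hx)
  have e2 := hC α left_mem_uIcc
  simp only [Pi.sub_apply, intervalIntegral.integral_same, sub_zero] at e1 e2
  rw [e2, ← e1]; abel

lemma const (c : E) : IsPrimitiveOn α β (fun _ => c) (fun _ => 0) :=
  ⟨intervalIntegrable_const, by simp⟩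

lemma add (h : α ≤ β) (hu : IsPrimitiveOn α β u v) (hu₁ : IsPrimitiveOn α β u₁ v₁) :
    IsPrimitiveOn α β (fun x => u x + u₁ x) (fun x => v x + v₁ x) := by
  refine ⟨hu.1.add hu₁.1, fun x hx => ?_⟩
  have hα : α ∈ Icc α β := left_mem_Icc.2 h
  rw [intervalIntegral.integral_add (hu.1.subinterval hα hx) (hu₁.1.subinterval hα hx)]
  beta_reduce
  rw [hu.2 x hx, hu₁.2 x hx]
  abel

lemma const_mul {𝕜 : Type*} [RCLike 𝕜] {u v : ℝ → 𝕜} (hu : IsPrimitiveOn α β u v) (c : 𝕜) :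
    IsPrimitiveOn α β (fun x => c * u x) (fun x => c * v x) := by
  refine ⟨hu.1.const_mul c, fun x hx => ?_⟩
  rw [intervalIntegral.integral_const_mul]
  beta_reduce
  rw [hu.2 x hx, mul_add]

lemma smul [CompleteSpace E] {r r' : ℝ → ℝ} (h : α ≤ β) (hr : IsPrimitiveOn α β r r')
    (hu : IsPrimitiveOn α β u v) :
    IsPrimitiveOn α β (fun x => r x • u x) (fun x => r' x • u x + r x • v x) := by
  refine of_absolutelyContinuous h
    ((hr.absolutelyContinuous h).smul (hu.absolutelyContinuous h)) ?_ ?_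
  · have h1 := hr.continuousOn
    have h2 := hu.continuousOn
    rw [← uIcc_of_le h] at h1 h2
    exact (hr.1.smul_continuousOn h2).add (hu.1.continuousOn_smul h1)
  · filter_upwards [hr.ae_hasDerivAt, hu.ae_hasDerivAt] with x h1 h2 hx
    rw [add_comm]
    exact (h1 hx).smul (h2 hx)

lemma mul {𝕜 : Type*} [RCLike 𝕜] {u v u₁ v₁ : ℝ → 𝕜} (h : α ≤ β)
    (hu : IsPrimitiveOn α β u v) (hu₁ : IsPrimitiveOn α β u₁ v₁) :
    IsPrimitiveOn α β (fun x => u x * u₁ x) (fun x => v x * u₁ x + u x * v₁ x) := by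
  refine of_absolutelyContinuous h
    ((hu.absolutelyContinuous h).smul (hu₁.absolutelyContinuous h)) ?_ ?_
  · have h1 := hu.continuousOn
    have h2 := hu₁.continuousOn
    rw [← uIcc_of_le h] at h1 h2
    exact (hu.1.mul_continuousOn h2).add (hu₁.1.continuousOn_mul h1)
  · filter_upwards [hu.ae_hasDerivAt, hu₁.ae_hasDerivAt] with x h1 h2 hx
    exact (h1 hx).mul (h2 hx)

lemma inv {𝕜 : Type*} [RCLike 𝕜] {u v : ℝ → 𝕜} (h : α ≤ β)
    (hu : IsPrimitiveOn α β u v) (h0 : ∀ x ∈ Icc α β, u x ≠ 0) :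
    IsPrimitiveOn α β (fun x => (u x)⁻¹) (fun x => - v x / u x ^ 2) := by
  have hi : ContinuousOn (fun x => (u x)⁻¹) (Icc α β) := hu.continuousOn.inv₀ h0
  obtain ⟨C, hC⟩ := isCompact_Icc.exists_bound_of_continuousOn hi
  have hC0 : 0 ≤ C := (norm_nonneg _).trans (hC α (left_mem_Icc.2 h))
  refine of_absolutelyContinuous h ?_ ?_ ?_
  · have h1 := (hu.absolutelyContinuous h)
    rw [absolutelyContinuousOnInterval_iff] at h1 ⊢
    intro ε hε
    obtain ⟨δ, hδ, H⟩ := h1 (ε / (C ^ 2 + 1)) (by positivity)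
    refine ⟨δ, hδ, fun D hD hs => ?_⟩
    have h2 := H D hD hs
    rw [lt_div_iff₀ (by positivity)] at h2
    refine lt_of_le_of_lt ?_ h2
    rw [Finset.sum_mul]
    refine Finset.sum_le_sum fun i hi => ?_
    have hm := hD.1 i hi
    rw [uIcc_of_le h] at hm
    have e : (u (D.2 i).1)⁻¹ - (u (D.2 i).2)⁻¹
        = - (u (D.2 i).1 - u (D.2 i).2) * ((u (D.2 i).1)⁻¹ * (u (D.2 i).2)⁻¹) := by
      have a1 := h0 _ hm.1
      have a2 := h0 _ hm.2
      field_simp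
      ring
    rw [dist_eq_norm, dist_eq_norm, e, norm_mul, norm_neg, norm_mul]
    refine mul_le_mul_of_nonneg_left ?_ (norm_nonneg _)
    nlinarith [mul_le_mul (hC _ hm.1) (hC _ hm.2) (norm_nonneg _) hC0]
  · have := IntervalIntegrable.mul_continuousOn_Icc h hu.1.neg (hi.pow 2)
    simpa [div_eq_mul_inv] using this
  · filter_upwards [hu.ae_hasDerivAt] with x h1 hx
    exact (h1 hx).inv (h0 x (Ioo_subset_Icc_self hx))

/-- Integration by parts without boundary terms, for `u` vanishing at `α` and `u₁` at `β`. -/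
lemma integral_mul_eq_neg {𝕜 : Type*} [RCLike 𝕜] {u v u₁ v₁ : ℝ → 𝕜} (h : α ≤ β)
    (hu : IsPrimitiveOn α β u v) (hu₁ : IsPrimitiveOn α β u₁ v₁) (h0 : u α = 0)
    (h1 : u₁ β = 0) : ∫ x in α..β, u x * v₁ x = - ∫ x in α..β, v x * u₁ x := by
  have hm := (hu.mul h hu₁).integral_eq (left_mem_Icc.2 h) (right_mem_Icc.2 h)
  rw [intervalIntegral.integral_add (IntervalIntegrable.mul_continuousOn_Icc h hu.1
    hu₁.continuousOn) ?_] at hm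
  · rw [h0, h1] at hm
    simp only [mul_zero, zero_mul, sub_zero] at hm
    exact eq_neg_of_add_eq_zero_right hm
  · simpa [mul_comm] using IntervalIntegrable.mul_continuousOn_Icc h hu₁.1 hu.continuousOn

end IsPrimitiveOn

end Primitive

/-! ### Recursion for the formal powers -/

section FormalPowers

variable {α β : ℝ} {a : ℝ → ℝ} {x₀ : ℝ}

lemma one_div_one_div_fun (a : ℝ → ℝ) : (fun x => 1 / (1 / a x)) = a := by
  funext x; exact one_div_one_div _

namespace IsProperImpedance

lemma inv (ha : IsProperImpedance α β a) : IsProperImpedance α β (fun x => 1 / a x) := by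
  refine ⟨ha.pos.mono fun x hx => one_div_pos.2 hx, ha.memLp_inv, ?_⟩
  rw [one_div_one_div_fun]
  exact ha.memLp

lemma intervalIntegrable_sq (ha : IsProperImpedance α β a) (h : α ≤ β) :
    IntervalIntegrable (fun x => a x ^ 2) volume α β :=
  (intervalIntegrable_iff_integrable_Ioo h).2 ha.memLp.integrable_sq

lemma intervalIntegrable_inv_sq (ha : IsProperImpedance α β a) (h : α ≤ β) :
    IntervalIntegrable (fun x => 1 / a x ^ 2) volume α β := by
  simpa using ha.inv.intervalIntegrable_sq h

end IsProperImpedance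

/-- The derivative of a formal power of `a` is, up to the weight `1 / a ^ 2`, a formal power of
`1 / a`. -/
lemma formalPower_succ (a : ℝ → ℝ) (x₀ : ℝ) (k : ℕ) (x : ℝ) :
    formalPower a x₀ (k + 1) x
      = ((k : ℝ) + 1) * ∫ t in x₀..x, 1 / a t ^ 2 * formalPower (fun x => 1 / a x) x₀ k t := by
  induction k using Nat.strong_induction_on generalizing a x with
  | _ k ih =>
    rcases k with _ | k
    · simp [formalPower]
    · have h : ∀ t, formalPower (fun x => 1 / a x) x₀ (k + 1) t
          = ((k : ℝ) + 1) * ∫ s in x₀..t, a s ^ 2 * formalPower a x₀ k s := by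
        intro t
        rw [ih k (Nat.lt_succ_self k) (fun x => 1 / a x) t, one_div_one_div_fun]
        simp
      simp only [h, formalPower]
      simp only [mul_left_comm _ ((k : ℝ) + 1), intervalIntegral.integral_const_mul]
      push_cast
      ring

lemma formalPower_isPrimitiveOn_and_continuousOn (h : α ≤ β) (hx₀ : x₀ ∈ Icc α β)
    (ha : IsProperImpedance α β a) (k : ℕ) :
    ContinuousOn (formalPower a x₀ k) (Icc α β) ∧
    IsPrimitiveOn α β (formalPower a x₀ (k + 1))
      (fun t => ((k : ℝ) + 1) * (1 / a t ^ 2 * formalPower (fun x => 1 / a x) x₀ k t)) := by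
  have step : ∀ (a : ℝ → ℝ), IsProperImpedance α β a →
      ContinuousOn (formalPower (fun x => 1 / a x) x₀ k) (Icc α β) →
      IsPrimitiveOn α β (formalPower a x₀ (k + 1))
      (fun t => ((k : ℝ) + 1) * (1 / a t ^ 2 * formalPower (fun x => 1 / a x) x₀ k t)) := by
    intro a ha hc
    have h1 := (IsPrimitiveOn.of_integral' h
      ((ha.intervalIntegrable_inv_sq h).mul_continuousOn_Icc h hc) hx₀).const_mul ((k : ℝ) + 1)
    exact h1.congr (fun x _ => formalPower_succ a x₀ k x)
      (Filter.Eventually.of_forall fun _ => rfl) h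
  have cont : ∀ (a : ℝ → ℝ), IsProperImpedance α β a →
      ContinuousOn (formalPower a x₀ k) (Icc α β) := by
    clear step
    induction k with
    | zero => intro a _; exact continuousOn_const
    | succ k ih =>
      intro a ha
      have h1 := (IsPrimitiveOn.of_integral' h
        ((ha.intervalIntegrable_inv_sq h).mul_continuousOn_Icc h (ih _ ha.inv)) hx₀).const_mul
          ((k : ℝ) + 1)
      exact h1.continuousOn.congr (fun x _ => formalPower_succ a x₀ k x)
  exact ⟨cont a ha, step a ha (cont _ ha.inv)⟩

lemma formalPower_continuousOn (h : α ≤ β) (hx₀ : x₀ ∈ Icc α β)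
    (ha : IsProperImpedance α β a) (k : ℕ) : ContinuousOn (formalPower a x₀ k) (Icc α β) :=
  (formalPower_isPrimitiveOn_and_continuousOn h hx₀ ha k).1

lemma formalPower_isPrimitiveOn (h : α ≤ β) (hx₀ : x₀ ∈ Icc α β)
    (ha : IsProperImpedance α β a) (k : ℕ) :
    IsPrimitiveOn α β (formalPower a x₀ (k + 1))
      (fun t => ((k : ℝ) + 1) * (1 / a t ^ 2 * formalPower (fun x => 1 / a x) x₀ k t)) :=
  (formalPower_isPrimitiveOn_and_continuousOn h hx₀ ha k).2

lemma continuousOn_of_mem_span_formalPower (h : α ≤ β) (hx₀ : x₀ ∈ Icc α β)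
    (ha : IsProperImpedance α β a) {s : ℝ → ℝ}
    (hs : s ∈ Submodule.span ℝ (range (formalPower a x₀))) : ContinuousOn s (Icc α β) := by
  induction hs using Submodule.span_induction with
  | mem x hx => obtain ⟨k, rfl⟩ := hx; exact formalPower_continuousOn h hx₀ ha k
  | zero => exact continuousOn_const
  | add x y _ _ hx hy => exact hx.add hy
  | smul c x _ hx => exact hx.const_smul c

end FormalPowers

/-! ### The Volterra operator and the Green operator -/

section Operators

variable {α β : ℝ} {a : ℝ → ℝ} {x₀ : ℝ} {g h : ℝ → ℝ}

/-- Twofold integration from `x₀`: the solution of `(a² u')' = g`, `u(x₀) = u'(x₀) = 0`. -/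
noncomputable def volterraOp (a : ℝ → ℝ) (x₀ : ℝ) (g : ℝ → ℝ) (x : ℝ) : ℝ :=
  ∫ t in x₀..x, 1 / a t ^ 2 * ∫ s in x₀..t, g s

/-- The Green operator: the solution of `(a² u')' = -g` with `u(α) = 0` and `(a² u')(β) = 0`. -/
noncomputable def greenOp (a : ℝ → ℝ) (α β : ℝ) (g : ℝ → ℝ) (x : ℝ) : ℝ :=
  ∫ t in α..x, 1 / a t ^ 2 * ∫ s in t..β, g s

lemma volterraOp_isPrimitiveOn (hαβ : α ≤ β) (hx₀ : x₀ ∈ Icc α β)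
    (ha : IsProperImpedance α β a) (hg : IntervalIntegrable g volume α β) :
    IsPrimitiveOn α β (volterraOp a x₀ g) (fun t => 1 / a t ^ 2 * ∫ s in x₀..t, g s) :=
  IsPrimitiveOn.of_integral' hαβ ((ha.intervalIntegrable_inv_sq hαβ).mul_continuousOn_Icc hαβ
    (IsPrimitiveOn.of_integral' hαβ hg hx₀).continuousOn) hx₀

lemma greenOp_isPrimitiveOn (hαβ : α ≤ β)
    (ha : IsProperImpedance α β a) (hg : IntervalIntegrable g volume α β) :
    IsPrimitiveOn α β (greenOp a α β g) (fun t => 1 / a t ^ 2 * ∫ s in t..β, g s) :=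
  IsPrimitiveOn.of_integral' hαβ ((ha.intervalIntegrable_inv_sq hαβ).mul_continuousOn_Icc hαβ
    (IsPrimitiveOn.of_integral_right hαβ hg).continuousOn) (left_mem_Icc.2 hαβ)

lemma volterraOp_add (hαβ : α ≤ β) (hx₀ : x₀ ∈ Icc α β) (ha : IsProperImpedance α β a)
    (hg : IntervalIntegrable g volume α β) (hh : IntervalIntegrable h volume α β)
    {x : ℝ} (hx : x ∈ Icc α β) :
    volterraOp a x₀ (fun x => g x + h x) x = volterraOp a x₀ g x + volterraOp a x₀ h x := by
  have i1 := (volterraOp_isPrimitiveOn hαβ hx₀ ha hg).1.subinterval hx₀ hx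
  have i2 := (volterraOp_isPrimitiveOn hαβ hx₀ ha hh).1.subinterval hx₀ hx
  unfold volterraOp
  rw [← intervalIntegral.integral_add i1 i2]
  refine intervalIntegral.integral_congr fun t ht => ?_
  have ht' : t ∈ Icc α β := uIcc_subset_Icc hx₀ hx ht
  simp only
  rw [intervalIntegral.integral_add (hg.subinterval hx₀ ht') (hh.subinterval hx₀ ht'), mul_add]

lemma volterraOp_const_mul (c : ℝ) (x : ℝ) :
    volterraOp a x₀ (fun x => c * g x) x = c * volterraOp a x₀ g x := by
  unfold volterraOp
  simp only [intervalIntegral.integral_const_mul, mul_left_comm _ c]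

lemma formalPower_add_two (k : ℕ) (x : ℝ) :
    formalPower a x₀ (k + 2) x = ((k : ℝ) + 2) * ((k : ℝ) + 1) *
      volterraOp a x₀ (fun x => a x ^ 2 * formalPower a x₀ k x) x := by
  rw [formalPower, volterraOp]

lemma volterraOp_mem_span (hαβ : α ≤ β) (hx₀ : x₀ ∈ Icc α β)
    (ha : IsProperImpedance α β a) {s : ℝ → ℝ}
    (hs : s ∈ Submodule.span ℝ (range (formalPower a x₀))) :
    ∃ s' ∈ Submodule.span ℝ (range (formalPower a x₀)), ∀ x ∈ Icc α β,
      volterraOp a x₀ (fun x => a x ^ 2 * s x) x = s' x := by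
  have hii : ∀ {s : ℝ → ℝ}, s ∈ Submodule.span ℝ (range (formalPower a x₀)) →
      IntervalIntegrable (fun x => a x ^ 2 * s x) volume α β := fun hs =>
    (ha.intervalIntegrable_sq hαβ).mul_continuousOn_Icc hαβ
      (continuousOn_of_mem_span_formalPower hαβ hx₀ ha hs)
  induction hs using Submodule.span_induction with
  | mem x hx =>
    obtain ⟨k, rfl⟩ := hx
    refine ⟨(((k : ℝ) + 2) * ((k : ℝ) + 1))⁻¹ • formalPower a x₀ (k + 2),
      Submodule.smul_mem _ _ (Submodule.subset_span ⟨_, rfl⟩), fun x _ => ?_⟩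
    rw [Pi.smul_apply, formalPower_add_two, smul_eq_mul, inv_mul_cancel_left₀ (by positivity)]
  | zero =>
    exact ⟨0, Submodule.zero_mem _, fun x _ => by simp [volterraOp]⟩
  | add u v hu hv ihu ihv =>
    obtain ⟨u', hu', eu⟩ := ihu
    obtain ⟨v', hv', ev⟩ := ihv
    refine ⟨u' + v', Submodule.add_mem _ hu' hv', fun x hx => ?_⟩
    rw [Pi.add_apply, ← eu x hx, ← ev x hx, ← volterraOp_add hαβ hx₀ ha (hii hu) (hii hv) hx]
    simp only [Pi.add_apply, mul_add]
  | smul c u hu ihu =>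
    obtain ⟨u', hu', eu⟩ := ihu
    refine ⟨c • u', Submodule.smul_mem _ c hu', fun x hx => ?_⟩
    rw [Pi.smul_apply, ← eu x hx, smul_eq_mul, ← volterraOp_const_mul]
    simp only [Pi.smul_apply, smul_eq_mul, mul_left_comm _ c]

/-- The Green operator is minus the Volterra operator up to the first two formal powers. -/
lemma greenOp_eq (hαβ : α ≤ β) (hx₀ : x₀ ∈ Icc α β)
    (ha : IsProperImpedance α β a) (hg : IntervalIntegrable g volume α β)
    {x : ℝ} (hx : x ∈ Icc α β) :
    greenOp a α β g x = greenOp a α β g x₀ * formalPower a x₀ 0 x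
      + (∫ s in x₀..β, g s) * formalPower a x₀ 1 x - volterraOp a x₀ g x := by
  have hβ : β ∈ Icc α β := right_mem_Icc.2 hαβ
  have hP := greenOp_isPrimitiveOn hαβ ha hg
  rw [hP.eq_add hx₀ hx, add_sub_assoc]
  simp only [formalPower, mul_one, add_right_inj]
  rw [volterraOp, ← intervalIntegral.integral_const_mul, ← intervalIntegral.integral_sub
    (((ha.intervalIntegrable_inv_sq hαβ).subinterval hx₀ hx).const_mul _)
    ((volterraOp_isPrimitiveOn hαβ hx₀ ha hg).1.subinterval hx₀ hx)]
  refine intervalIntegral.integral_congr fun t ht => ?_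
  have ht' : t ∈ Icc α β := uIcc_subset_Icc hx₀ hx ht
  rw [← intervalIntegral.integral_add_adjacent_intervals (hg.subinterval hx₀ ht')
    (hg.subinterval ht' hβ)]
  ring

/-- The bilinear form of the Green operator; it is visibly symmetric and nonnegative. -/
lemma integral_mul_greenOp (hαβ : α ≤ β) (ha : IsProperImpedance α β a)
    (hg : IntervalIntegrable g volume α β) (hh : IntervalIntegrable h volume α β) :
    ∫ x in α..β, g x * greenOp a α β h x
      = ∫ t in α..β, 1 / a t ^ 2 * ((∫ s in t..β, g s) * ∫ s in t..β, h s) := by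
  have h1 := IsPrimitiveOn.integral_mul_eq_neg hαβ (greenOp_isPrimitiveOn hαβ ha hh)
    (IsPrimitiveOn.of_integral_right hαβ hg) (by simp [greenOp]) (by simp)
  have e1 : ∀ x, g x * greenOp a α β h x = -(greenOp a α β h x * -g x) := fun x => by ring
  simp only [e1, intervalIntegral.integral_neg, h1, neg_neg]
  exact intervalIntegral.integral_congr fun t _ => by ring

lemma integral_mul_greenOp_comm (hαβ : α ≤ β) (ha : IsProperImpedance α β a)
    (hg : IntervalIntegrable g volume α β) (hh : IntervalIntegrable h volume α β) :
    ∫ x in α..β, g x * greenOp a α β h x = ∫ x in α..β, h x * greenOp a α β g x := by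
  rw [integral_mul_greenOp hαβ ha hg hh, integral_mul_greenOp hαβ ha hh hg]
  exact intervalIntegral.integral_congr fun t _ => by ring

/-- The annihilator of the formal powers is invariant under the Green operator. -/
lemma greenOp_annihilates (hαβ : α ≤ β) (hx₀ : x₀ ∈ Icc α β) (ha : IsProperImpedance α β a)
    (hg : IntervalIntegrable g volume α β)
    (h0 : ∀ k, ∫ x in α..β, g x * formalPower a x₀ k x = 0) (k : ℕ) :
    ∫ x in α..β, (a x ^ 2 * greenOp a α β g x) * formalPower a x₀ k x = 0 := by
  have hc := formalPower_continuousOn hαβ hx₀ ha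
  have hw : IntervalIntegrable (fun x => a x ^ 2 * formalPower a x₀ k x) volume α β :=
    (ha.intervalIntegrable_sq hαβ).mul_continuousOn_Icc hαβ (hc k)
  have hi := fun k => hg.mul_continuousOn_Icc hαβ (hc k)
  have e1 : ∀ x, (a x ^ 2 * greenOp a α β g x) * formalPower a x₀ k x
      = (a x ^ 2 * formalPower a x₀ k x) * greenOp a α β g x := fun x => by ring
  simp only [e1]
  rw [integral_mul_greenOp_comm hαβ ha hw hg]
  set c₀ := greenOp a α β (fun x => a x ^ 2 * formalPower a x₀ k x) x₀
  set c₁ := ∫ s in x₀..β, a s ^ 2 * formalPower a x₀ k s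
  set c₂ := (((k : ℝ) + 2) * ((k : ℝ) + 1))⁻¹
  have e2 : ∀ x ∈ uIcc α β,
      g x * greenOp a α β (fun x => a x ^ 2 * formalPower a x₀ k x) x
      = c₀ * (g x * formalPower a x₀ 0 x) + c₁ * (g x * formalPower a x₀ 1 x)
        - c₂ * (g x * formalPower a x₀ (k + 2) x) := by
    intro x hx
    rw [uIcc_of_le hαβ] at hx
    have e3 : volterraOp a x₀ (fun x => a x ^ 2 * formalPower a x₀ k x) x
        = c₂ * formalPower a x₀ (k + 2) x := by
      rw [formalPower_add_two, inv_mul_cancel_left₀ (by positivity)]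
    rw [greenOp_eq hαβ hx₀ ha hw hx, e3]
    ring
  rw [intervalIntegral.integral_congr e2, intervalIntegral.integral_sub
    (((hi 0).const_mul c₀).add ((hi 1).const_mul c₁)) ((hi (k + 2)).const_mul c₂),
    intervalIntegral.integral_add ((hi 0).const_mul c₀) ((hi 1).const_mul c₁)]
  simp only [intervalIntegral.integral_const_mul, h0, mul_zero, add_zero, sub_zero]

lemma integral_mul_eq_zero_of_mem_span (hαβ : α ≤ β) (hx₀ : x₀ ∈ Icc α β)
    (ha : IsProperImpedance α β a) (hg : IntervalIntegrable g volume α β)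
    (h0 : ∀ k, ∫ x in α..β, g x * formalPower a x₀ k x = 0) {s : ℝ → ℝ}
    (hs : s ∈ Submodule.span ℝ (range (formalPower a x₀))) :
    ∫ x in α..β, g x * s x = 0 := by
  have hi : ∀ {s : ℝ → ℝ}, s ∈ Submodule.span ℝ (range (formalPower a x₀)) →
      IntervalIntegrable (fun x => g x * s x) volume α β := fun hs =>
    hg.mul_continuousOn_Icc hαβ (continuousOn_of_mem_span_formalPower hαβ hx₀ ha hs)
  induction hs using Submodule.span_induction with
  | mem x hx => obtain ⟨k, rfl⟩ := hx; exact h0 k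
  | zero => simp
  | add u v hu hv ihu ihv =>
    simp only [Pi.add_apply, mul_add]
    rw [intervalIntegral.integral_add (hi hu) (hi hv), ihu, ihv, add_zero]
  | smul c u hu ihu =>
    simp only [Pi.smul_apply, smul_eq_mul, mul_left_comm _ c]
    rw [intervalIntegral.integral_const_mul, ihu, mul_zero]

end Operators

/-! ### A function annihilating all formal powers vanishes -/

section Annihilator

variable {α β : ℝ} {a : ℝ → ℝ} {x₀ : ℝ} {g : ℝ → ℝ}

lemma ae_restrict_Icc_of_Ioo {P : ℝ → Prop} (h : ∀ᵐ x ∂volume.restrict (Ioo α β), P x) :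
    ∀ᵐ x ∂volume.restrict (Icc α β), P x := by
  rwa [← restrict_Ioo_eq_restrict_Icc]

/-- Monotonicity of the absolute value of oriented integrals inside `[α, β]`. -/
lemma abs_intervalIntegral_mul_le {r F G : ℝ → ℝ} (h : α ≤ β)
    (hr : IntervalIntegrable r volume α β)
    (hr0 : ∀ᵐ x ∂volume.restrict (Ioo α β), 0 < r x) (hG : ContinuousOn G (Icc α β))
    {x y : ℝ} (hx : x ∈ Icc α β) (hy : y ∈ Icc α β) (hFG : ∀ t ∈ uIcc x y, |F t| ≤ G t) :
    |∫ t in x..y, r t * F t| ≤ |∫ t in x..y, r t * G t| := by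
  rw [← Real.norm_eq_abs]
  refine intervalIntegral.norm_integral_le_abs_of_norm_le ?_
    ((hr.mul_continuousOn_Icc h hG).subinterval hx hy)
  have h1 : Ι x y ⊆ Icc α β := uIoc_subset_uIcc.trans (uIcc_subset_Icc hx hy)
  filter_upwards [ae_restrict_of_ae_restrict_of_subset h1 (ae_restrict_Icc_of_Ioo hr0),
    ae_restrict_mem measurableSet_uIoc] with t h2 h3
  rw [Real.norm_eq_abs, abs_mul, abs_of_pos h2]
  exact mul_le_mul_of_nonneg_left (hFG t (uIoc_subset_uIcc h3)) h2.le

lemma IsPrimitiveOn.pow_succ {u v : ℝ → ℝ} (h : α ≤ β) (hu : IsPrimitiveOn α β u v) (n : ℕ) :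
    IsPrimitiveOn α β (fun x => u x ^ (n + 1)) (fun x => (n + 1) * (v x * u x ^ n)) := by
  induction n with
  | zero => simpa using hu
  | succ n ih =>
    refine (ih.mul h hu).congr (fun x _ => by ring) (Filter.Eventually.of_forall fun x => ?_) h
    simp only
    push_cast
    ring

/-- The power rule for the distance `|∫ q|` from the base point. -/
lemma abs_integral_mul_abs_pow {q : ℝ → ℝ} (h : α ≤ β) (hx₀ : x₀ ∈ Icc α β)
    (hq : IntervalIntegrable q volume α β)
    (hq0 : ∀ᵐ x ∂volume.restrict (Ioo α β), 0 < q x) (n : ℕ) {x : ℝ} (hx : x ∈ Icc α β) :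
    |∫ t in x₀..x, q t * |∫ s in x₀..t, q s| ^ n|
      = |∫ s in x₀..x, q s| ^ (n + 1) / (n + 1) := by
  have hP := (IsPrimitiveOn.of_integral' h hq hx₀).pow_succ h n
  have key : ∫ t in x₀..x, q t * (∫ s in x₀..t, q s) ^ n
      = (∫ s in x₀..x, q s) ^ (n + 1) / (n + 1) := by
    have h1 := hP.integral_eq hx₀ hx
    rw [intervalIntegral.integral_const_mul, intervalIntegral.integral_same, zero_pow (by omega),
      sub_zero] at h1
    rw [← h1, mul_div_cancel_left₀ _ (by positivity)]
  have key2 : |∫ t in x₀..x, q t * (∫ s in x₀..t, q s) ^ n|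
      = |∫ s in x₀..x, q s| ^ (n + 1) / (n + 1) := by
    rw [key, abs_div, abs_pow, abs_of_pos (by positivity : (0 : ℝ) < n + 1)]
  have hnn : ∀ {y z : ℝ}, y ∈ Icc α β → z ∈ Icc α β → y ≤ z → 0 ≤ ∫ s in y..z, q s := by
    intro y z hy hz hyz
    refine intervalIntegral.integral_nonneg_of_ae_restrict hyz ?_
    have h1 := ae_restrict_of_ae_restrict_of_subset (Icc_subset_Icc hy.1 hz.2)
      (ae_restrict_Icc_of_Ioo hq0)
    exact h1.mono fun t ht => ht.le
  rw [← key2]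
  rcases le_total x₀ x with hle | hle
  · congr 1
    refine intervalIntegral.integral_congr fun t ht => ?_
    have ht' : t ∈ Icc α β := uIcc_subset_Icc hx₀ hx ht
    rw [uIcc_of_le hle] at ht
    rw [abs_of_nonneg (hnn hx₀ ht' ht.1)]
  · have e : ∀ t ∈ uIcc x₀ x, q t * |∫ s in x₀..t, q s| ^ n
        = (-1) ^ n * (q t * (∫ s in x₀..t, q s) ^ n) := by
      intro t ht
      have ht' : t ∈ Icc α β := uIcc_subset_Icc hx₀ hx ht
      rw [uIcc_of_ge hle] at ht
      have h2 := hnn ht' hx₀ ht.2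
      rw [intervalIntegral.integral_symm] at h2
      rw [abs_of_nonpos (by linarith), neg_pow]
      ring
    rw [intervalIntegral.integral_congr e, intervalIntegral.integral_const_mul, abs_mul]
    simp

/-- One step of the factorial decay of the iterates of the Volterra operator. -/
lemma abs_volterraOp_le (h : α ≤ β) (hx₀ : x₀ ∈ Icc α β) (ha : IsProperImpedance α β a)
    {u : ℝ → ℝ} {M : ℝ} (hM0 : 0 ≤ M) {n : ℕ}
    (hM : ∀ x ∈ Icc α β, |u x| ≤ M * |∫ s in x₀..x, 1 / a s ^ 2| ^ n) {x : ℝ}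
    (hx : x ∈ Icc α β) :
    |volterraOp a x₀ (fun x => a x ^ 2 * u x) x|
      ≤ ((∫ s in α..β, a s ^ 2) * M / (n + 1)) * |∫ s in x₀..x, 1 / a s ^ 2| ^ (n + 1) := by
  have hw := ha.intervalIntegrable_sq h
  have hq := ha.intervalIntegrable_inv_sq h
  have hw0 : ∀ᵐ x ∂volume.restrict (Ioo α β), 0 < a x ^ 2 := ha.pos.mono fun x hx => by positivity
  have hq0 : ∀ᵐ x ∂volume.restrict (Ioo α β), 0 < 1 / a x ^ 2 :=
    ha.pos.mono fun x hx => by positivity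
  set ρ : ℝ → ℝ := fun x => |∫ s in x₀..x, 1 / a s ^ 2| with hρ
  have hρc : ContinuousOn ρ (Icc α β) := (IsPrimitiveOn.of_integral' h hq hx₀).continuousOn.abs
  have hαm : α ∈ Icc α β := left_mem_Icc.2 h
  have hβm : β ∈ Icc α β := right_mem_Icc.2 h
  have hIcc : ∀ {P : ℝ → Prop}, (∀ᵐ x ∂volume.restrict (Ioo α β), P x) →
      ∀ᵐ x ∂volume.restrict (Ι α β), P x := fun hP =>
    ae_restrict_of_ae_restrict_of_subset (uIoc_subset_uIcc.trans_eq (uIcc_of_le h))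
      (ae_restrict_Icc_of_Ioo hP)
  have hsub : ∀ {y z : ℝ}, y ∈ Icc α β → z ∈ Icc α β → Ι y z ⊆ Ι α β := fun hy hz =>
    uIoc_subset_uIoc_of_uIcc_subset_uIcc
      (uIcc_subset_uIcc (Icc_subset_uIcc hy) (Icc_subset_uIcc hz))
  have hW0 : 0 ≤ ∫ s in α..β, a s ^ 2 :=
    intervalIntegral.integral_nonneg h fun s _ => sq_nonneg _
  -- the inner integral is controlled because `ρ` increases away from `x₀`
  have inner : ∀ t ∈ uIcc x₀ x, |∫ s in x₀..t, a s ^ 2 * u s|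
      ≤ (∫ s in α..β, a s ^ 2) * M * ρ t ^ n := by
    intro t ht
    have htm : t ∈ Icc α β := uIcc_subset_Icc hx₀ hx ht
    have hρle : ∀ s ∈ uIcc x₀ t, ρ s ≤ ρ t := by
      intro s hs
      have hsm : s ∈ Icc α β := uIcc_subset_Icc hx₀ htm hs
      refine intervalIntegral.abs_integral_mono_interval
        (uIoc_subset_uIoc_of_uIcc_subset_uIcc (uIcc_subset_uIcc left_mem_uIcc hs)) ?_
        (hq.subinterval hx₀ htm)
      exact ae_restrict_of_ae_restrict_of_subset (hsub hx₀ htm)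
        (hIcc (hq0.mono fun _ hx => hx.le))
    have hMt : 0 ≤ M * ρ t ^ n := (abs_nonneg _).trans (hM t htm)
    have h1 : ∀ s ∈ uIcc x₀ t, |u s| ≤ M * ρ t ^ n := by
      intro s hs
      have hsm : s ∈ Icc α β := uIcc_subset_Icc hx₀ htm hs
      exact (hM s hsm).trans (mul_le_mul_of_nonneg_left
        (pow_le_pow_left₀ (abs_nonneg _) (hρle s hs) n) hM0)
    have h2 := abs_intervalIntegral_mul_le h hw hw0 continuousOn_const hx₀ htm h1
    rw [intervalIntegral.integral_mul_const, abs_mul, abs_of_nonneg hMt] at h2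
    refine h2.trans ?_
    rw [mul_assoc]
    refine mul_le_mul_of_nonneg_right ?_ hMt
    rw [← abs_of_nonneg hW0]
    exact intervalIntegral.abs_integral_mono_interval (hsub hx₀ htm)
      (hIcc (hw0.mono fun _ hx => hx.le)) hw
  have hc : ContinuousOn (fun t => (∫ s in α..β, a s ^ 2) * M * ρ t ^ n) (Icc α β) :=
    continuousOn_const.mul (hρc.pow n)
  have h3 := abs_intervalIntegral_mul_le h hq hq0 hc hx₀ hx inner
  unfold volterraOp
  refine h3.trans ?_
  have e : ∀ t, 1 / a t ^ 2 * ((∫ s in α..β, a s ^ 2) * M * ρ t ^ n)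
      = (∫ s in α..β, a s ^ 2) * M * (1 / a t ^ 2 * ρ t ^ n) := fun t => by ring
  simp only [e, intervalIntegral.integral_const_mul]
  rw [abs_mul, abs_integral_mul_abs_pow h hx₀ hq hq0 n hx]
  rw [abs_of_nonneg (mul_nonneg hW0 hM0)]
  apply le_of_eq
  ring

/-- A continuous function with vanishing weighted `L²` norm is zero. -/
lemma eq_zero_of_integral_mul_sq_eq_zero {r u : ℝ → ℝ} (h : α < β)
    (hr : IntervalIntegrable r volume α β)
    (hr0 : ∀ᵐ x ∂volume.restrict (Ioo α β), 0 < r x) (hu : ContinuousOn u (Icc α β))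
    (h0 : ∫ x in α..β, r x * u x ^ 2 = 0) : ∀ x ∈ Icc α β, u x = 0 := by
  have hi : Integrable (fun x => r x * u x ^ 2) (volume.restrict (Ioo α β)) :=
    (intervalIntegrable_iff_integrable_Ioo h.le).1 (hr.mul_continuousOn_Icc h.le (hu.pow 2))
  rw [intervalIntegral_eq_integral_Ioo h.le,
    integral_eq_zero_iff_of_nonneg_ae (hr0.mono fun x hx => by simp only [Pi.zero_apply]; positivity)
      hi] at h0
  have h1 : u =ᵐ[volume.restrict (Icc α β)] fun _ => 0 := by
    refine ae_restrict_Icc_of_Ioo ?_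
    filter_upwards [h0, hr0] with x hx hx'
    simpa [hx'.ne'] using hx
  exact Measure.eqOn_Icc_of_ae_eq volume h.ne h1 hu continuousOn_const

end Annihilator

/-! ### Iterates of the Green operator -/

section Iteration

variable {α β : ℝ} {a : ℝ → ℝ} {x₀ : ℝ} {g : ℝ → ℝ}

/-- The iterates `g, a² T g, (a² T)² g, …` of a density under the Green operator `T`. -/
noncomputable def greenIter (a : ℝ → ℝ) (α β : ℝ) (g : ℝ → ℝ) : ℕ → ℝ → ℝ
  | 0 => g
  | n + 1 => fun x => a x ^ 2 * greenOp a α β (greenIter a α β g n) x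

/-- The iterates of the density `g` under the Volterra operator, with the sign that makes them
agree with the Green iterates modulo the formal powers. -/
noncomputable def volterraIter (a : ℝ → ℝ) (x₀ : ℝ) (g : ℝ → ℝ) : ℕ → ℝ → ℝ
  | 0 => fun x => - volterraOp a x₀ g x
  | n + 1 => fun x => - volterraOp a x₀ (fun x => a x ^ 2 * volterraIter a x₀ g n x) x

lemma greenIter_intervalIntegrable (h : α ≤ β) (ha : IsProperImpedance α β a)
    (hg : IntervalIntegrable g volume α β) (n : ℕ) :
    IntervalIntegrable (greenIter a α β g n) volume α β := by
  induction n with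
  | zero => exact hg
  | succ n ih =>
    exact (ha.intervalIntegrable_sq h).mul_continuousOn_Icc h
      (greenOp_isPrimitiveOn h ha ih).continuousOn

lemma volterraIter_continuousOn (h : α ≤ β) (hx₀ : x₀ ∈ Icc α β) (ha : IsProperImpedance α β a)
    (hg : IntervalIntegrable g volume α β) (n : ℕ) :
    ContinuousOn (volterraIter a x₀ g n) (Icc α β) := by
  induction n with
  | zero => exact (volterraOp_isPrimitiveOn h hx₀ ha hg).continuousOn.neg
  | succ n ih =>
    exact (volterraOp_isPrimitiveOn h hx₀ ha
      ((ha.intervalIntegrable_sq h).mul_continuousOn_Icc h ih)).continuousOn.neg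

lemma greenIter_annihilates (h : α ≤ β) (hx₀ : x₀ ∈ Icc α β) (ha : IsProperImpedance α β a)
    (hg : IntervalIntegrable g volume α β)
    (h0 : ∀ k, ∫ x in α..β, g x * formalPower a x₀ k x = 0) (n k : ℕ) :
    ∫ x in α..β, greenIter a α β g n x * formalPower a x₀ k x = 0 := by
  induction n generalizing k with
  | zero => exact h0 k
  | succ n ih =>
    exact greenOp_annihilates h hx₀ ha (greenIter_intervalIntegrable h ha hg n) ih k

/-- The Green iterates and the Volterra iterates differ by combinations of formal powers. -/
lemma greenOp_greenIter_eq (h : α ≤ β) (hx₀ : x₀ ∈ Icc α β) (ha : IsProperImpedance α β a)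
    (hg : IntervalIntegrable g volume α β) (n : ℕ) :
    ∃ s ∈ Submodule.span ℝ (range (formalPower a x₀)), ∀ x ∈ Icc α β,
      greenOp a α β (greenIter a α β g n) x = volterraIter a x₀ g n x + s x := by
  have hmem : ∀ k, formalPower a x₀ k ∈ Submodule.span ℝ (range (formalPower a x₀)) :=
    fun k => Submodule.subset_span ⟨k, rfl⟩
  have hw := ha.intervalIntegrable_sq h
  induction n with
  | zero =>
    refine ⟨_, Submodule.add_mem _ (Submodule.smul_mem _ (greenOp a α β g x₀) (hmem 0))
      (Submodule.smul_mem _ (∫ s in x₀..β, g s) (hmem 1)), fun x hx => ?_⟩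
    simp only [greenIter, volterraIter, greenOp_eq h hx₀ ha hg hx, Pi.add_apply, Pi.smul_apply,
      smul_eq_mul]
    ring
  | succ n ih =>
    obtain ⟨s, hs, e⟩ := ih
    obtain ⟨s', hs', e'⟩ := volterraOp_mem_span h hx₀ ha hs
    have hi := greenIter_intervalIntegrable h ha hg (n + 1)
    set G := greenIter a α β g (n + 1) with hG
    refine ⟨_, Submodule.sub_mem _ (Submodule.add_mem _
      (Submodule.smul_mem _ (greenOp a α β G x₀) (hmem 0))
      (Submodule.smul_mem _ (∫ s in x₀..β, G s) (hmem 1))) hs', fun x hx => ?_⟩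
    have e2 : volterraOp a x₀ G x
        = volterraOp a x₀ (fun x => a x ^ 2 * volterraIter a x₀ g n x) x + s' x := by
      rw [← e' x hx, ← volterraOp_add h hx₀ ha
        (hw.mul_continuousOn_Icc h (volterraIter_continuousOn h hx₀ ha hg n))
        (hw.mul_continuousOn_Icc h (continuousOn_of_mem_span_formalPower h hx₀ ha hs)) hx]
      unfold volterraOp
      refine intervalIntegral.integral_congr fun t ht => ?_
      have ht' : t ∈ Icc α β := uIcc_subset_Icc hx₀ hx ht
      simp only
      congr 1
      refine intervalIntegral.integral_congr fun y hy => ?_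
      have hy' : y ∈ Icc α β := uIcc_subset_Icc hx₀ ht' hy
      simp only [hG, greenIter]
      rw [e y hy', mul_add]
    simp only [volterraIter, greenOp_eq h hx₀ ha hi hx, e2, Pi.add_apply, Pi.sub_apply,
      Pi.smul_apply, smul_eq_mul]
    ring

lemma abs_volterraIter_le (h : α ≤ β) (hx₀ : x₀ ∈ Icc α β) (ha : IsProperImpedance α β a)
    (hg : IntervalIntegrable g volume α β) :
    ∃ M, 0 ≤ M ∧ ∀ n, ∀ x ∈ Icc α β, |volterraIter a x₀ g n x|
      ≤ (∫ s in α..β, a s ^ 2) ^ n * M / n.factorial * |∫ s in x₀..x, 1 / a s ^ 2| ^ n := by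
  have hW0 : 0 ≤ ∫ s in α..β, a s ^ 2 :=
    intervalIntegral.integral_nonneg h fun s _ => sq_nonneg _
  obtain ⟨M, hM⟩ := isCompact_Icc.exists_bound_of_continuousOn
    (volterraIter_continuousOn h hx₀ ha hg 0)
  have hM0 : 0 ≤ M := (norm_nonneg _).trans (hM α (left_mem_Icc.2 h))
  refine ⟨M, hM0, fun n => ?_⟩
  induction n with
  | zero => intro x hx; simpa using hM x hx
  | succ n ih =>
    intro x hx
    have h1 := abs_volterraOp_le h hx₀ ha (by positivity) ih hx
    simp only [volterraIter, abs_neg]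
    refine h1.trans (le_of_eq ?_)
    rw [Nat.factorial_succ]
    push_cast
    field_simp
    ring

lemma abs_greenOp_greenIter_le (h : α ≤ β) (ha : IsProperImpedance α β a)
    (hg : IntervalIntegrable g volume α β) :
    ∃ M, 0 ≤ M ∧ ∀ n, ∀ x ∈ Icc α β, |greenOp a α β (greenIter a α β g n) x|
      ≤ ((∫ s in α..β, a s ^ 2) * ∫ s in α..β, 1 / a s ^ 2) ^ n * M := by
  have hw := ha.intervalIntegrable_sq h
  have hq := ha.intervalIntegrable_inv_sq h
  have hw0 : ∀ᵐ x ∂volume.restrict (Ioo α β), 0 < a x ^ 2 := ha.pos.mono fun x hx => by positivity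
  have hq0 : ∀ᵐ x ∂volume.restrict (Ioo α β), 0 < 1 / a x ^ 2 :=
    ha.pos.mono fun x hx => by positivity
  have hmono : ∀ {r : ℝ → ℝ}, IntervalIntegrable r volume α β → (∀ x, 0 ≤ r x) → ∀ {y z : ℝ},
      y ∈ Icc α β → z ∈ Icc α β → |∫ s in y..z, r s| ≤ ∫ s in α..β, r s := by
    intro r hr hr0 y z hy hz
    rw [← abs_of_nonneg (intervalIntegral.integral_nonneg h fun s _ => hr0 s :
      0 ≤ ∫ s in α..β, r s)]
    exact intervalIntegral.abs_integral_mono_interval (uIoc_subset_uIoc_of_uIcc_subset_uIcc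
      (uIcc_subset_uIcc (Icc_subset_uIcc hy) (Icc_subset_uIcc hz)))
      (Filter.Eventually.of_forall hr0) hr
  have hW0 : 0 ≤ ∫ s in α..β, a s ^ 2 :=
    intervalIntegral.integral_nonneg h fun s _ => sq_nonneg _
  have hQ0 : 0 ≤ ∫ s in α..β, 1 / a s ^ 2 :=
    intervalIntegral.integral_nonneg h fun s _ => by positivity
  have hαm : α ∈ Icc α β := left_mem_Icc.2 h
  have hβm : β ∈ Icc α β := right_mem_Icc.2 h
  obtain ⟨M, hM⟩ := isCompact_Icc.exists_bound_of_continuousOn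
    (greenOp_isPrimitiveOn h ha hg).continuousOn
  have hM0 : 0 ≤ M := (norm_nonneg _).trans (hM α hαm)
  refine ⟨M, hM0, fun n => ?_⟩
  induction n with
  | zero => intro x hx; simpa [greenIter] using hM x hx
  | succ n ih =>
    intro x hx
    set W := ∫ s in α..β, a s ^ 2
    set Q := ∫ s in α..β, 1 / a s ^ 2
    set B := (W * Q) ^ n * M with hB
    have hB0 : 0 ≤ B := by positivity
    have inner : ∀ t ∈ uIcc α x, |∫ s in t..β, greenIter a α β g (n + 1) s| ≤ W * B := by
      intro t ht
      have ht' : t ∈ Icc α β := uIcc_subset_Icc hαm hx ht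
      have h1 := abs_intervalIntegral_mul_le h hw hw0 continuousOn_const ht' hβm
        fun s hs => ih s (uIcc_subset_Icc ht' hβm hs)
      rw [intervalIntegral.integral_mul_const, abs_mul, abs_of_nonneg hB0] at h1
      exact h1.trans (mul_le_mul_of_nonneg_right (hmono hw (fun _ => sq_nonneg _) ht' hβm) hB0)
    have h2 := abs_intervalIntegral_mul_le h hq hq0 continuousOn_const hαm hx inner
    rw [intervalIntegral.integral_mul_const, abs_mul, abs_of_nonneg (by positivity : 0 ≤ W * B)]
      at h2
    refine h2.trans ((mul_le_mul_of_nonneg_right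
      (hmono hq (fun _ => by positivity) hαm hx) (by positivity)).trans (le_of_eq ?_))
    rw [hB]
    ring

/-- The energies `∫ a² (T gₙ)²`, where `gₙ` are the Green iterates of an annihilating density, decay
faster than any geometric sequence: modulo the formal powers, to which `a² T gₙ` is orthogonal, one
factor is a Volterra iterate. -/
lemma exists_pow_mul_energy_le (h : α ≤ β) (hx₀ : x₀ ∈ Icc α β) (ha : IsProperImpedance α β a)
    (hg : IntervalIntegrable g volume α β)
    (h0 : ∀ k, ∫ x in α..β, g x * formalPower a x₀ k x = 0) (l : ℝ) (hl : 0 < l) :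
    ∃ C, ∀ n, l ^ n * ∫ x in α..β,
      a x ^ 2 * greenOp a α β (greenIter a α β g n) x ^ 2 ≤ C := by
  obtain ⟨M₁, hM₁, hG⟩ := abs_greenOp_greenIter_le h ha hg
  obtain ⟨M₂, hM₂, hV⟩ := abs_volterraIter_le h hx₀ ha hg
  have hw := ha.intervalIntegrable_sq h
  have hq := ha.intervalIntegrable_inv_sq h
  have hw0 : ∀ᵐ x ∂volume.restrict (Ioo α β), 0 < a x ^ 2 := ha.pos.mono fun x hx => by positivity
  have hαm : α ∈ Icc α β := left_mem_Icc.2 h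
  have hβm : β ∈ Icc α β := right_mem_Icc.2 h
  have hW0 : 0 ≤ ∫ s in α..β, a s ^ 2 :=
    intervalIntegral.integral_nonneg h fun s _ => sq_nonneg _
  have hQ0 : 0 ≤ ∫ s in α..β, 1 / a s ^ 2 :=
    intervalIntegral.integral_nonneg h fun s _ => by positivity
  set W := ∫ s in α..β, a s ^ 2
  set Q := ∫ s in α..β, 1 / a s ^ 2
  have hρ : ∀ x ∈ Icc α β, |∫ s in x₀..x, 1 / a s ^ 2| ≤ Q := by
    intro x hx
    rw [← abs_of_nonneg hQ0]
    exact intervalIntegral.abs_integral_mono_interval (uIoc_subset_uIoc_of_uIcc_subset_uIcc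
      (uIcc_subset_uIcc (Icc_subset_uIcc hx₀) (Icc_subset_uIcc hx)))
      (Filter.Eventually.of_forall fun _ => by positivity) hq
  refine ⟨M₁ * M₂ * W * Real.exp (l * (W * Q) * (W * Q)), fun n => ?_⟩
  obtain ⟨s, hs, e⟩ := greenOp_greenIter_eq h hx₀ ha hg n
  have hi := greenIter_intervalIntegrable h ha hg (n + 1)
  have hVc := volterraIter_continuousOn h hx₀ ha hg n
  have hsc := continuousOn_of_mem_span_formalPower h hx₀ ha hs
  have e1 : ∫ x in α..β, a x ^ 2 * greenOp a α β (greenIter a α β g n) x ^ 2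
      = ∫ x in α..β, a x ^ 2 *
        (greenOp a α β (greenIter a α β g n) x * volterraIter a x₀ g n x) := by
    have e2 : ∀ x ∈ uIcc α β, a x ^ 2 * greenOp a α β (greenIter a α β g n) x ^ 2
        = greenIter a α β g (n + 1) x * volterraIter a x₀ g n x
          + greenIter a α β g (n + 1) x * s x := by
      intro x hx
      rw [uIcc_of_le h] at hx
      rw [← mul_add, ← e x hx]
      simp only [greenIter]
      ring
    rw [intervalIntegral.integral_congr e2, intervalIntegral.integral_add
      (hi.mul_continuousOn_Icc h hVc) (hi.mul_continuousOn_Icc h hsc),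
      integral_mul_eq_zero_of_mem_span h hx₀ ha hi (greenIter_annihilates h hx₀ ha hg h0 (n + 1))
        hs, add_zero]
    refine intervalIntegral.integral_congr fun x _ => ?_
    simp only [greenIter, mul_assoc]
  set D := (W * Q) ^ n * M₁ * (W ^ n * M₂ / n.factorial * Q ^ n) with hD
  have hD0 : 0 ≤ D := by positivity
  have h1 := abs_intervalIntegral_mul_le (F := fun x =>
      greenOp a α β (greenIter a α β g n) x * volterraIter a x₀ g n x) (G := fun _ => D) h hw hw0
    continuousOn_const hαm hβm (by
      intro x hx
      rw [uIcc_of_le h] at hx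
      rw [abs_mul]
      refine mul_le_mul (hG n x hx) ((hV n x hx).trans ?_) (abs_nonneg _) (by positivity)
      exact mul_le_mul_of_nonneg_left (pow_le_pow_left₀ (abs_nonneg _) (hρ x hx) n)
        (by positivity))
  rw [intervalIntegral.integral_mul_const, abs_of_nonneg (by positivity : 0 ≤ W * D)] at h1
  rw [e1]
  calc l ^ n * _ ≤ l ^ n * (W * D) := by
        gcongr
        exact (le_abs_self _).trans h1
    _ = M₁ * M₂ * W * ((l * (W * Q) * (W * Q)) ^ n / n.factorial) := by
        rw [hD]; ring
    _ ≤ _ := by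
        gcongr
        exact Real.pow_div_factorial_le_exp _ (by positivity) n

/-- A bounded convex sequence does not increase. -/
lemma apply_one_le_apply_zero_of_convex_of_bounded {D : ℕ → ℝ} {C : ℝ}
    (hconv : ∀ n, 2 * D (n + 1) ≤ D n + D (n + 2)) (hb : ∀ n, D n ≤ C) : D 1 ≤ D 0 := by
  by_contra! hlt
  have h1 : ∀ n, D 1 - D 0 ≤ D (n + 1) - D n := by
    intro n
    induction n with
    | zero => exact le_rfl
    | succ n ih => have := hconv n; linarith
  have h2 : ∀ n : ℕ, D 0 + n * (D 1 - D 0) ≤ D n := by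
    intro n
    induction n with
    | zero => simp
    | succ n ih => have := h1 n; push_cast; linarith
  obtain ⟨n, hn⟩ := exists_nat_gt ((C - D 0) / (D 1 - D 0))
  rw [div_lt_iff₀ (by linarith)] at hn
  have := h2 n
  have := hb n
  linarith

/-- The energies of the Green iterates satisfy `2 dₙ₊₁ ≤ dₙ / l + l dₙ₊₂`. -/
lemma energy_convex (h : α ≤ β) (ha : IsProperImpedance α β a)
    (hg : IntervalIntegrable g volume α β) (l : ℝ) (n : ℕ) :
    2 * (l * ∫ x in α..β, a x ^ 2 * greenOp a α β (greenIter a α β g (n + 1)) x ^ 2)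
      ≤ (∫ x in α..β, a x ^ 2 * greenOp a α β (greenIter a α β g n) x ^ 2)
        + l ^ 2 * ∫ x in α..β, a x ^ 2 * greenOp a α β (greenIter a α β g (n + 2)) x ^ 2 := by
  have hw := ha.intervalIntegrable_sq h
  have hi := fun n => greenIter_intervalIntegrable h ha hg n
  have hc := fun n => (greenOp_isPrimitiveOn h ha (hi n)).continuousOn
  have hprod : ∀ m k, IntervalIntegrable (fun x => a x ^ 2 *
      (greenOp a α β (greenIter a α β g m) x * greenOp a α β (greenIter a α β g k) x))
      volume α β := fun m k => hw.mul_continuousOn_Icc h ((hc m).mul (hc k))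
  -- self-adjointness moves one factor of the Green operator across
  have hsymm : ∫ x in α..β, a x ^ 2 * (greenOp a α β (greenIter a α β g n) x *
        greenOp a α β (greenIter a α β g (n + 2)) x)
      = ∫ x in α..β, a x ^ 2 * (greenOp a α β (greenIter a α β g (n + 1)) x *
        greenOp a α β (greenIter a α β g (n + 1)) x) := by
    have := integral_mul_greenOp_comm h ha (hi (n + 1)) (hi (n + 2))
    simpa only [greenIter, mul_assoc] using this
  have hpos : 0 ≤ ∫ x in α..β, a x ^ 2 * (greenOp a α β (greenIter a α β g n) x
      - l * greenOp a α β (greenIter a α β g (n + 2)) x) ^ 2 :=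
    intervalIntegral.integral_nonneg h fun x _ => by positivity
  have e : ∀ x, a x ^ 2 * (greenOp a α β (greenIter a α β g n) x
      - l * greenOp a α β (greenIter a α β g (n + 2)) x) ^ 2
      = a x ^ 2 * (greenOp a α β (greenIter a α β g n) x * greenOp a α β (greenIter a α β g n) x)
      + l ^ 2 * (a x ^ 2 * (greenOp a α β (greenIter a α β g (n + 2)) x *
          greenOp a α β (greenIter a α β g (n + 2)) x))
      - 2 * l * (a x ^ 2 * (greenOp a α β (greenIter a α β g n) x *
          greenOp a α β (greenIter a α β g (n + 2)) x)) := fun x => by ring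
  simp only [e] at hpos
  rw [intervalIntegral.integral_sub ((hprod _ _).add ((hprod _ _).const_mul _))
    ((hprod _ _).const_mul _), intervalIntegral.integral_add (hprod _ _)
    ((hprod _ _).const_mul _), intervalIntegral.integral_const_mul,
    intervalIntegral.integral_const_mul, hsymm] at hpos
  simp only [← sq] at hpos
  linarith

/-- An integrable density that annihilates all formal powers vanishes almost everywhere. -/
theorem ae_eq_zero_of_annihilates_formalPower (h : α < β) (hx₀ : x₀ ∈ Icc α β)
    (ha : IsProperImpedance α β a) (hg : IntervalIntegrable g volume α β)
    (h0 : ∀ k, ∫ x in α..β, g x * formalPower a x₀ k x = 0) :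
    g =ᵐ[volume.restrict (Ioo α β)] fun _ => 0 := by
  have hw := ha.intervalIntegrable_sq h.le
  have hq := ha.intervalIntegrable_inv_sq h.le
  have hw0 : ∀ᵐ x ∂volume.restrict (Ioo α β), 0 < a x ^ 2 := ha.pos.mono fun x hx => by positivity
  have hq0 : ∀ᵐ x ∂volume.restrict (Ioo α β), 0 < 1 / a x ^ 2 :=
    ha.pos.mono fun x hx => by positivity
  have hi := fun n => greenIter_intervalIntegrable h.le ha hg n
  have hc := fun n => (greenOp_isPrimitiveOn h.le ha (hi n)).continuousOn
  set d : ℕ → ℝ := fun n => ∫ x in α..β, a x ^ 2 * greenOp a α β (greenIter a α β g n) x ^ 2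
    with hd
  have hd0 : ∀ n, 0 ≤ d n := fun n =>
    intervalIntegral.integral_nonneg h.le fun x _ => by positivity
  have hle : ∀ l : ℝ, 0 < l → l * d 1 ≤ d 0 := by
    intro l hl
    obtain ⟨C, hC⟩ := exists_pow_mul_energy_le h.le hx₀ ha hg h0 l hl
    have := apply_one_le_apply_zero_of_convex_of_bounded (D := fun n => l ^ n * d n) (C := C)
      (fun n => by
        have h1 := mul_le_mul_of_nonneg_left (energy_convex h.le ha hg l n) (pow_nonneg hl.le n)
        simp only [hd]
        ring_nf at h1 ⊢
        exact h1) hC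
    simpa using this
  have hd1 : d 1 = 0 := by
    by_contra hne
    have hpos : 0 < d 1 := lt_of_le_of_ne (hd0 1) (Ne.symm hne)
    have := hle ((d 0 + 1) / d 1) (div_pos (by linarith [hd0 0]) hpos)
    rw [div_mul_cancel₀ _ hne] at this
    linarith
  have hRc := fun n => (IsPrimitiveOn.of_integral_right h.le (hi n)).continuousOn
  -- the Green operator is injective: its quadratic form is `∫ (∫ₜ g)² / a²`
  have hinj : ∀ n, (∀ x ∈ Icc α β, greenOp a α β (greenIter a α β g n) x = 0) →
      ∀ x ∈ Icc α β, ∫ s in x..β, greenIter a α β g n s = 0 := by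
    intro n hn
    refine eq_zero_of_integral_mul_sq_eq_zero h hq hq0 (hRc n) ?_
    have h1 := integral_mul_greenOp h.le ha (hi n) (hi n)
    simp only [← sq] at h1
    rw [← h1]
    have : ∀ x ∈ uIcc α β, greenIter a α β g n x * greenOp a α β (greenIter a α β g n) x
        = 0 := by
      intro x hx
      rw [uIcc_of_le h.le] at hx
      rw [hn x hx, mul_zero]
    rw [intervalIntegral.integral_congr this]
    simp
  have h2 := hinj 1 (eq_zero_of_integral_mul_sq_eq_zero h hw hw0 (hc 1) hd1)
  have h3 : d 0 = 0 := by
    have h1 := integral_mul_greenOp h.le ha (hi 1) (hi 0)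
    have e : ∀ t ∈ uIcc α β, 1 / a t ^ 2 * ((∫ s in t..β, greenIter a α β g 1 s)
        * ∫ s in t..β, greenIter a α β g 0 s) = 0 := by
      intro t ht
      rw [uIcc_of_le h.le] at ht
      rw [h2 t ht, zero_mul, mul_zero]
    rw [intervalIntegral.integral_congr e, intervalIntegral.integral_zero] at h1
    rw [← h1, hd]
    refine intervalIntegral.integral_congr fun x _ => ?_
    simp only [greenIter]
    ring
  have h4 := hinj 0 (eq_zero_of_integral_mul_sq_eq_zero h hw hw0 (hc 0) h3)
  rw [Filter.EventuallyEq, ae_restrict_iff' measurableSet_Ioo]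
  filter_upwards [(IsPrimitiveOn.of_integral_right h.le hg).ae_hasDerivAt] with x hx hx'
  have h5 := (hx hx').congr_of_eventuallyEq (f₁ := fun _ => (0 : ℝ)) (by
    filter_upwards [Ioo_mem_nhds hx'.1 hx'.2] with y hy
    exact (h4 y (Ioo_subset_Icc_self hy)).symm)
  have h6 := h5.unique (hasDerivAt_const x (0 : ℝ))
  linarith

end Iteration

/-! ### Quantitative Sobolev classes -/

/-- `u` belongs to `W^{m,p}(α, β)` with norm at most `δ`. The norm used is the
maximum of the absolute values at `α` of `u, …, u^{(m-1)}` and the `L^p` norm of `u^{(m)}`; it is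
equivalent to the usual one. Measuring the lower derivatives by their values at `α` makes the
class of order `m + 1` directly computable from that of order `m`. -/
def SobolevBound (α β : ℝ) (p : ℝ≥0∞) : ℕ → ℝ≥0 → (ℝ → ℂ) → Prop
  | 0, δ, u => AEStronglyMeasurable u (volume.restrict (Ioo α β)) ∧
      eLpNorm u p (volume.restrict (Ioo α β)) ≤ δ
  | m + 1, δ, u => ∃ U v : ℝ → ℂ, IsPrimitiveOn α β U v ∧ ‖U α‖ ≤ δ ∧ SobolevBound α β p m δ v ∧
      u =ᵐ[volume.restrict (Ioo α β)] U

section SobolevBound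

variable {α β : ℝ} {p : ℝ≥0∞} {u v : ℝ → ℂ}

namespace SobolevBound

lemma congr {m : ℕ} {δ : ℝ≥0} (hu : SobolevBound α β p m δ u)
    (h : v =ᵐ[volume.restrict (Ioo α β)] u) : SobolevBound α β p m δ v := by
  cases m with
  | zero => exact ⟨hu.1.congr h.symm, by rw [eLpNorm_congr_ae h]; exact hu.2⟩
  | succ m =>
    obtain ⟨U, w, h1, h2, h3, h4⟩ := hu
    exact ⟨U, w, h1, h2, h3, h.trans h4⟩

lemma mono {m : ℕ} {δ δ' : ℝ≥0} (hδ : δ ≤ δ') (hu : SobolevBound α β p m δ u) :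
    SobolevBound α β p m δ' u := by
  induction m generalizing u with
  | zero => exact ⟨hu.1, hu.2.trans (by exact_mod_cast hδ)⟩
  | succ m ih =>
    obtain ⟨U, w, h1, h2, h3, h4⟩ := hu
    exact ⟨U, w, h1, h2.trans (by exact_mod_cast hδ), ih h3, h4⟩

lemma add (hp : 1 ≤ p) (h : α ≤ β) {m : ℕ} {δ δ' : ℝ≥0} (hu : SobolevBound α β p m δ u)
    (hv : SobolevBound α β p m δ' v) : SobolevBound α β p m (δ + δ') (fun x => u x + v x) := by
  induction m generalizing u v with
  | zero =>
    refine ⟨hu.1.add hv.1, (eLpNorm_add_le hu.1 hv.1 hp).trans ?_⟩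
    push_cast
    exact add_le_add hu.2 hv.2
  | succ m ih =>
    obtain ⟨U, w, h1, h2, h3, h4⟩ := hu
    obtain ⟨U', w', h1', h2', h3', h4'⟩ := hv
    refine ⟨_, _, h1.add h h1', ?_, ih h3 h3', h4.add h4'⟩
    push_cast
    exact (norm_add_le _ _).trans (add_le_add h2 h2')

lemma const_mul (c : ℂ) {m : ℕ} {δ : ℝ≥0} (hu : SobolevBound α β p m δ u) :
    SobolevBound α β p m (‖c‖₊ * δ) (fun x => c * u x) := by
  induction m generalizing u with
  | zero =>
    refine ⟨hu.1.const_mul c, ?_⟩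
    have := eLpNorm_const_smul_le (c := c) (f := u) (p := p) (μ := volume.restrict (Ioo α β))
    refine this.trans ?_
    push_cast
    exact mul_le_mul_right hu.2 _
  | succ m ih =>
    obtain ⟨U, w, h1, h2, h3, h4⟩ := hu
    refine ⟨_, _, h1.const_mul c, ?_, ih h3, h4.mono fun x hx => by simp only [hx]⟩
    rw [norm_mul]
    push_cast
    exact mul_le_mul_of_nonneg_left h2 (norm_nonneg _)

end SobolevBound

/-- Hölder's inequality: on a bounded interval the `L¹` norm is controlled by the `L^p` norm. -/
lemma exists_integral_norm_le_of_eLpNorm_le (hp : 1 ≤ p) (h : α ≤ β) :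
    ∃ C : ℝ≥0, ∀ (δ : ℝ≥0) (v : ℝ → ℂ), AEStronglyMeasurable v (volume.restrict (Ioo α β)) →
      eLpNorm v p (volume.restrict (Ioo α β)) ≤ δ →
      IntervalIntegrable v volume α β ∧ ∫ x in α..β, ‖v x‖ ≤ C * δ := by
  set μ := volume.restrict (Ioo α β)
  set K : ℝ≥0∞ := μ univ ^ (1 / (1 : ℝ≥0∞).toReal - 1 / p.toReal) with hK
  have hKt : K ≠ ⊤ := by
    refine ENNReal.rpow_ne_top_of_nonneg ?_ (measure_ne_top _ _)
    rcases eq_or_ne p ⊤ with rfl | hpt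
    · simp
    · have : 1 ≤ p.toReal := by
        rw [← ENNReal.toReal_one]; exact ENNReal.toReal_mono hpt hp
      simp only [ENNReal.toReal_one, div_one, sub_nonneg]
      exact div_le_one_of_le₀ this (by positivity)
  refine ⟨K.toNNReal, fun δ v hv hδ => ?_⟩
  have hm : MemLp v p μ := ⟨hv, hδ.trans_lt ENNReal.coe_lt_top⟩
  have hi : Integrable v μ := hm.integrable hp
  refine ⟨(intervalIntegrable_iff_integrable_Ioo h).2 hi, ?_⟩
  rw [intervalIntegral_eq_integral_Ioo h]
  have h1 : ENNReal.ofReal (∫ x, ‖v x‖ ∂μ) ≤ K * δ := by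
    rw [ofReal_integral_norm_eq_lintegral_enorm hi, ← eLpNorm_one_eq_lintegral_enorm]
    refine (eLpNorm_le_eLpNorm_mul_rpow_measure_univ hp hv).trans ?_
    rw [mul_comm, ← hK]
    exact mul_le_mul_right hδ _
  rw [← ENNReal.coe_toNNReal hKt, ← ENNReal.coe_mul] at h1
  have h2 := (ENNReal.ofReal_le_iff_le_toReal ENNReal.coe_ne_top).1 h1
  simpa using h2

lemma IsPrimitiveOn.norm_le {U v : ℝ → ℂ} (hU : IsPrimitiveOn α β U v) {x : ℝ}
    (hx : x ∈ Icc α β) : ‖U x‖ ≤ ‖U α‖ + ∫ t in α..β, ‖v t‖ := by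
  have h : α ≤ β := hx.1.trans hx.2
  rw [hU.2 x hx]
  refine (norm_add_le _ _).trans (add_le_add le_rfl ?_)
  refine (intervalIntegral.norm_integral_le_integral_norm hx.1).trans ?_
  exact intervalIntegral.integral_mono_interval le_rfl hx.1 hx.2
    (Filter.Eventually.of_forall fun _ => norm_nonneg _) hU.1.norm

lemma eLpNorm_le_of_norm_le (p : ℝ≥0∞) (α β : ℝ) : ∃ C : ℝ≥0, ∀ (δ : ℝ≥0) (u : ℝ → ℂ),
    (∀ᵐ x ∂volume.restrict (Ioo α β), ‖u x‖ ≤ δ) →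
    eLpNorm u p (volume.restrict (Ioo α β)) ≤ (C * δ : ℝ≥0) := by
  refine ⟨((volume.restrict (Ioo α β)) univ ^ p.toReal⁻¹).toNNReal, fun δ u hu => ?_⟩
  refine (eLpNorm_le_of_ae_bound hu).trans (le_of_eq ?_)
  rw [ENNReal.coe_mul, ENNReal.coe_toNNReal, ENNReal.ofReal_coe_nnreal]
  exact ENNReal.rpow_ne_top_of_nonneg (by positivity) (measure_ne_top _ _)

lemma IsPrimitiveOn.aestronglyMeasurable {U : ℝ → ℂ} (hU : IsPrimitiveOn α β U v) :
    AEStronglyMeasurable U (volume.restrict (Ioo α β)) :=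
  (hU.continuousOn.mono Ioo_subset_Icc_self).aestronglyMeasurable measurableSet_Ioo

/-- A function vanishing at `α` with derivative bounded in `L^p` is uniformly bounded. -/
lemma exists_norm_le_of_eLpNorm_deriv_le (hp : 1 ≤ p) (h : α ≤ β) :
    ∃ C : ℝ≥0, ∀ (δ : ℝ≥0) (U v : ℝ → ℂ), IsPrimitiveOn α β U v → ‖U α‖ ≤ δ →
      AEStronglyMeasurable v (volume.restrict (Ioo α β)) →
      eLpNorm v p (volume.restrict (Ioo α β)) ≤ δ → ∀ x ∈ Icc α β, ‖U x‖ ≤ (C * δ : ℝ≥0) := by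
  obtain ⟨C, hC⟩ := exists_integral_norm_le_of_eLpNorm_le (α := α) (β := β) hp h
  refine ⟨1 + C, fun δ U v hU h0 hv hδ x hx => ?_⟩
  refine (hU.norm_le hx).trans ?_
  push_cast
  linarith [(hC δ v hv hδ).2]

namespace SobolevBound

lemma exists_eLpNorm_le (hp : 1 ≤ p) (h : α ≤ β) (m : ℕ) :
    ∃ C : ℝ≥0, ∀ (δ : ℝ≥0) (u : ℝ → ℂ), SobolevBound α β p m δ u →
      AEStronglyMeasurable u (volume.restrict (Ioo α β)) ∧
      eLpNorm u p (volume.restrict (Ioo α β)) ≤ (C * δ : ℝ≥0) := by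
  induction m with
  | zero => exact ⟨1, fun δ u hu => by simpa using! hu⟩
  | succ m ih =>
    obtain ⟨C, hC⟩ := ih
    obtain ⟨C₁, hC₁⟩ := exists_norm_le_of_eLpNorm_deriv_le (α := α) (β := β) hp h
    obtain ⟨C₂, hC₂⟩ := eLpNorm_le_of_norm_le p α β
    refine ⟨C₂ * (C₁ * max C 1), fun δ u hu => ?_⟩
    obtain ⟨U, w, h1, h2, h3, h4⟩ := hu
    refine ⟨h1.aestronglyMeasurable.congr h4.symm, ?_⟩
    rw [eLpNorm_congr_ae h4, mul_assoc, mul_assoc]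
    refine hC₂ _ U (ae_Ioo_of_ae_Icc (hC₁ (max C 1 * δ) U w h1 (h2.trans ?_) (hC δ w h3).1
      ((hC δ w h3).2.trans ?_)))
    · have : δ ≤ max C 1 * δ := le_mul_of_one_le_left zero_le (le_max_right _ _)
      exact_mod_cast this
    · have : C * δ ≤ max C 1 * δ := mul_le_mul_left (le_max_left _ _) _
      exact_mod_cast this

/-- The embedding of `W^{m+1,p}` into the bounded functions. -/
lemma exists_norm_le (hp : 1 ≤ p) (h : α ≤ β) (m : ℕ) :
    ∃ C : ℝ≥0, ∀ (δ : ℝ≥0) (u : ℝ → ℂ), SobolevBound α β p (m + 1) δ u →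
      ∀ᵐ x ∂volume.restrict (Ioo α β), ‖u x‖ ≤ (C * δ : ℝ≥0) := by
  obtain ⟨C, hC⟩ := exists_eLpNorm_le (α := α) (β := β) hp h m
  obtain ⟨C₁, hC₁⟩ := exists_norm_le_of_eLpNorm_deriv_le (α := α) (β := β) hp h
  refine ⟨C₁ * max C 1, fun δ u hu => ?_⟩
  obtain ⟨U, w, h1, h2, h3, h4⟩ := hu
  have h5 := hC₁ (max C 1 * δ) U w h1 (h2.trans (by
    have : δ ≤ max C 1 * δ := le_mul_of_one_le_left zero_le (le_max_right _ _)
    exact_mod_cast this)) (hC δ w h3).1 ((hC δ w h3).2.trans (by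
    have : C * δ ≤ max C 1 * δ := mul_le_mul_left (le_max_left _ _) _
    exact_mod_cast this))
  filter_upwards [h4, ae_Ioo_of_ae_Icc h5] with x hx hx'
  rw [hx, mul_assoc]
  exact hx'

lemma exists_pred (hp : 1 ≤ p) (h : α ≤ β) (m : ℕ) :
    ∃ C : ℝ≥0, ∀ (δ : ℝ≥0) (u : ℝ → ℂ), SobolevBound α β p (m + 1) δ u →
      SobolevBound α β p m (C * δ) u := by
  induction m with
  | zero =>
    obtain ⟨C, hC⟩ := exists_eLpNorm_le (α := α) (β := β) hp h 1
    exact ⟨C, fun δ u hu => hC δ u hu⟩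
  | succ m ih =>
    obtain ⟨C, hC⟩ := ih
    refine ⟨max C 1, fun δ u hu => ?_⟩
    obtain ⟨U, w, h1, h2, h3, h4⟩ := hu
    refine ⟨U, w, h1, h2.trans ?_, (hC δ w h3).mono (mul_le_mul_left (le_max_left _ _) _), h4⟩
    have : δ ≤ max C 1 * δ := le_mul_of_one_le_left zero_le (le_max_right _ _)
    exact_mod_cast this

lemma exists_of_le (hp : 1 ≤ p) (h : α ≤ β) {j m : ℕ} (hjm : j ≤ m) :
    ∃ C : ℝ≥0, ∀ (δ : ℝ≥0) (u : ℝ → ℂ), SobolevBound α β p m δ u →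
      SobolevBound α β p j (C * δ) u := by
  induction m, hjm using Nat.le_induction with
  | base => exact ⟨1, fun δ u hu => by simpa using hu⟩
  | succ m _ ih =>
    obtain ⟨C, hC⟩ := ih
    obtain ⟨C', hC'⟩ := exists_pred (α := α) (β := β) hp h m
    exact ⟨C * C', fun δ u hu => by rw [mul_assoc]; exact hC _ u (hC' δ u hu)⟩

/-- `W^{j,p}` is a module over `W^{max(j,1),p}`. -/
lemma exists_mul (hp : 1 ≤ p) (h : α ≤ β) (j : ℕ) :
    ∃ C : ℝ≥0, ∀ (δ K : ℝ≥0) (u b : ℝ → ℂ), SobolevBound α β p j δ u →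
      SobolevBound α β p (max j 1) K b → SobolevBound α β p j (C * δ * K) (fun x => b x * u x) := by
  induction j with
  | zero =>
    obtain ⟨C, hC⟩ := exists_norm_le (α := α) (β := β) hp h 0
    obtain ⟨C', hC'⟩ := exists_eLpNorm_le (α := α) (β := β) hp h 1
    refine ⟨C, fun δ K u b hu hb => ?_⟩
    refine ⟨(hC' K b hb).1.mul hu.1, ?_⟩
    have h1 : ∀ᵐ x ∂volume.restrict (Ioo α β), ‖b x * u x‖₊ ≤ (C * K) * ‖u x‖₊ := by
      filter_upwards [hC K b hb] with x hx
      rw [nnnorm_mul]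
      exact mul_le_mul_left (show ‖b x‖₊ ≤ C * K from hx) _
    refine (eLpNorm_le_nnreal_smul_eLpNorm_of_ae_le_mul h1 p).trans ?_
    rw [ENNReal.smul_def, smul_eq_mul, mul_right_comm, ENNReal.coe_mul (C * K)]
    exact mul_le_mul_right hu.2 _
  | succ j ih =>
    obtain ⟨C, hC⟩ := ih
    obtain ⟨C₁, hC₁⟩ := exists_of_le (α := α) (β := β) hp h
      (show max j 1 ≤ j + 1 by omega)
    refine ⟨max 1 (C * C₁ + C * C₁), fun δ K u b hu hb => ?_⟩
    rw [show max (j + 1) 1 = j + 1 by omega] at hb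
    have hu' := hu
    have hb' := hb
    obtain ⟨U, w, h1, h2, h3, h4⟩ := hu
    obtain ⟨B, w', h1', h2', h3', h4'⟩ := hb
    have s1 := hC K (C₁ * δ) w' U h3' (hC₁ δ U (hu'.congr h4.symm))
    have s2 := hC δ (C₁ * K) w B h3 (hC₁ K B (hb'.congr h4'.symm))
    refine ⟨_, _, h1'.mul h h1, ?_, ?_, h4'.mul h4⟩
    · rw [norm_mul, mul_assoc]
      have e1 : (1 : ℝ) ≤ (max 1 (C * C₁ + C * C₁) : ℝ≥0) := by
        exact_mod_cast le_max_left _ _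
      calc ‖B α‖ * ‖U α‖ ≤ K * δ := mul_le_mul h2' h2 (norm_nonneg _) K.2
        _ = 1 * (δ * K) := by ring
        _ ≤ _ := by
          push_cast at e1 ⊢
          exact mul_le_mul_of_nonneg_right e1 (by positivity)
    · have s3 := add hp h s1 s2
      refine (s3.congr (Filter.Eventually.of_forall fun x => ?_)).mono ?_
      · simp only
        ring
      · calc C * K * (C₁ * δ) + C * δ * (C₁ * K) = (C * C₁ + C * C₁) * δ * K := by ring
          _ ≤ _ := by gcongr; exact le_max_right _ _

end SobolevBound

end SobolevBound

/-! ### Multipliers of the Sobolev classes -/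

/-- Multiplication by `b` is a bounded operator on `W^{m,p}(α, β)`. -/
def IsSobolevMultiplier (α β : ℝ) (p : ℝ≥0∞) (m : ℕ) (b : ℝ → ℂ) : Prop :=
  ∃ C : ℝ≥0, ∀ (δ : ℝ≥0) (u : ℝ → ℂ), SobolevBound α β p m δ u →
    SobolevBound α β p m (C * δ) (fun x => b x * u x)

section Multiplier

variable {α β : ℝ} {p : ℝ≥0∞} {b b' : ℝ → ℂ}

lemma IsSobolevMultiplier.mul {m : ℕ} (hb : IsSobolevMultiplier α β p m b)
    (hb' : IsSobolevMultiplier α β p m b') :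
    IsSobolevMultiplier α β p m (fun x => b x * b' x) := by
  obtain ⟨C, hC⟩ := hb
  obtain ⟨C', hC'⟩ := hb'
  refine ⟨C * C', fun δ u hu => ?_⟩
  rw [mul_assoc]
  exact (hC _ _ (hC' δ u hu)).congr (Filter.Eventually.of_forall fun x => by
    simp only [mul_assoc])

lemma SobolevBound.isSobolevMultiplier (hp : 1 ≤ p) (h : α ≤ β) {j : ℕ} {K : ℝ≥0}
    (hb : SobolevBound α β p (max j 1) K b) : IsSobolevMultiplier α β p j b := by
  obtain ⟨C, hC⟩ := SobolevBound.exists_mul (α := α) (β := β) hp h j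
  refine ⟨C * K, fun δ u hu => ?_⟩
  rw [mul_right_comm]
  exact hC δ K u b hu hb

lemma isSobolevMultiplier_zero_of_bound (hb : AEStronglyMeasurable b (volume.restrict (Ioo α β)))
    {K : ℝ≥0} (hK : ∀ᵐ x ∂volume.restrict (Ioo α β), ‖b x‖ ≤ K) :
    IsSobolevMultiplier α β p 0 b := by
  refine ⟨K, fun δ u hu => ⟨hb.mul hu.1, ?_⟩⟩
  have h1 : ∀ᵐ x ∂volume.restrict (Ioo α β), ‖b x * u x‖₊ ≤ K * ‖u x‖₊ := by
    filter_upwards [hK] with x hx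
    rw [nnnorm_mul]
    exact mul_le_mul_left (show ‖b x‖₊ ≤ K from hx) _
  refine (eLpNorm_le_nnreal_smul_eLpNorm_of_ae_le_mul h1 p).trans ?_
  rw [ENNReal.smul_def, smul_eq_mul, ENNReal.coe_mul]
  exact mul_le_mul_right hu.2 _

/-- The reciprocal of a Sobolev function bounded away from zero is a Sobolev function. -/
lemma SobolevBound.exists_inv (hp : 1 ≤ p) (h : α < β) (j : ℕ) {K M : ℝ≥0}
    (hb : SobolevBound α β p (j + 1) K b)
    (hM : ∀ᵐ x ∂volume.restrict (Ioo α β), ‖(b x)⁻¹‖ ≤ M)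
    (h0 : ∀ᵐ x ∂volume.restrict (Ioo α β), b x ≠ 0) :
    ∃ K', SobolevBound α β p (j + 1) K' (fun x => (b x)⁻¹) := by
  have hb' := hb
  obtain ⟨B, w, h1, h2, h3, h4⟩ := hb
  -- the continuous representative inherits the lower bound at every point
  have hlow : ∀ x ∈ Icc α β, 1 ≤ M * ‖B x‖ := by
    have hcl : IsClosed {x | x ∈ Icc α β ∧ 1 ≤ M * ‖B x‖} :=
      (continuousOn_const.mul h1.continuousOn.norm).preimage_isClosed_of_isClosed isClosed_Icc
        isClosed_Ici
    have hae : ∀ᵐ x ∂volume.restrict (Ioo α β), 1 ≤ M * ‖B x‖ := by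
      filter_upwards [hM, h0, h4] with x hx hx0 hx4
      rw [← hx4]
      rw [norm_inv] at hx
      have : 0 < ‖b x‖ := norm_pos_iff.2 hx0
      rwa [← div_le_iff₀ this, one_div]
    have hsub : Ioo α β ⊆ closure {x | x ∈ Icc α β ∧ 1 ≤ M * ‖B x‖} := by
      intro x hx
      rw [mem_closure_iff]
      intro o ho hxo
      by_contra hemp
      rw [not_nonempty_iff_eq_empty] at hemp
      rw [ae_restrict_iff' measurableSet_Ioo] at hae
      have hnull : volume (o ∩ Ioo α β) = 0 := by
        refine measure_mono_null (fun y hy => ?_) hae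
        intro hcon
        have : y ∈ o ∩ {x | x ∈ Icc α β ∧ 1 ≤ M * ‖B x‖} :=
          ⟨hy.1, Ioo_subset_Icc_self hy.2, hcon hy.2⟩
        rw [hemp] at this
        exact this
      exact ((ho.inter isOpen_Ioo).measure_pos volume ⟨x, hxo, hx⟩).ne' hnull
    rw [hcl.closure_eq] at hsub
    intro x hx
    rw [← closure_Ioo h.ne] at hx
    exact (hcl.closure_subset_iff.2 hsub hx).2
  have hB0 : ∀ x ∈ Icc α β, B x ≠ 0 := by
    intro x hx hcon
    have := hlow x hx
    rw [hcon, norm_zero, mul_zero] at this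
    linarith
  have hP := h1.inv h.le hB0
  have hinv : (fun x => (b x)⁻¹) =ᵐ[volume.restrict (Ioo α β)] fun x => (B x)⁻¹ :=
    h4.mono fun x hx => by simp only [hx]
  have hmult : IsSobolevMultiplier α β p j (fun x => (b x)⁻¹) := by
    induction j generalizing K b w B with
    | zero =>
      refine isSobolevMultiplier_zero_of_bound ?_ hM
      exact hP.aestronglyMeasurable.congr hinv.symm
    | succ j ih =>
      obtain ⟨C, hC⟩ := SobolevBound.exists_pred (α := α) (β := β) hp h.le (j + 1)
      have hbj := hC K b hb'
      obtain ⟨B', w', g1, g2, g3, g4⟩ := hbj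
      have heq : ∀ x ∈ Icc α β, B' x = B x :=
        Measure.eqOn_Icc_of_ae_eq volume h.ne (ae_restrict_Icc_of_Ioo (g4.symm.trans h4))
          g1.continuousOn h1.continuousOn
      have hmj := ih hM h0 (hC K b hb') B' w' g1 g2 g3 g4
        (fun x hx => by rw [heq x hx]; exact hlow x hx)
        (fun x hx => by rw [heq x hx]; exact hB0 x hx)
        (g1.inv h.le fun x hx => by rw [heq x hx]; exact hB0 x hx)
        (g4.mono fun x hx => by simp only [hx])
      obtain ⟨C₁, hC₁⟩ := hmj.mul hmj
      obtain ⟨C₂, hC₂⟩ := SobolevBound.exists_pred (α := α) (β := β) hp h.le j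
      have hder : SobolevBound α β p j (‖(-1 : ℂ)‖₊ * (C₁ * (C₂ * K)))
          (fun x => - w x / B x ^ 2) := by
        refine ((hC₁ _ w (hC₂ K w h3)).const_mul (-1)).congr ?_
        filter_upwards [h4] with x hx
        rw [hx]
        ring
      have hj : SobolevBound α β p (j + 1)
          (max (‖(B α)⁻¹‖₊) (‖(-1 : ℂ)‖₊ * (C₁ * (C₂ * K)))) (fun x => (b x)⁻¹) := by
        refine ⟨_, _, hP, ?_, hder.mono (le_max_right _ _), hinv⟩
        have := le_max_left (‖(B α)⁻¹‖₊) (‖(-1 : ℂ)‖₊ * (C₁ * (C₂ * K)))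
        exact_mod_cast this
      have hj' : max (j + 1) 1 = j + 1 := by omega
      rw [← hj'] at hj
      exact SobolevBound.isSobolevMultiplier hp h.le hj
  obtain ⟨C₁, hC₁⟩ := hmult.mul hmult
  have hder : SobolevBound α β p j (‖(-1 : ℂ)‖₊ * (C₁ * K)) (fun x => - w x / B x ^ 2) := by
    refine ((hC₁ _ w h3).const_mul (-1)).congr ?_
    filter_upwards [h4] with x hx
    rw [hx]
    ring
  refine ⟨max (‖(B α)⁻¹‖₊) (‖(-1 : ℂ)‖₊ * (C₁ * K)), _, _, hP, ?_,
    hder.mono (le_max_right _ _), hinv⟩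
  have := le_max_left (‖(B α)⁻¹‖₊) (‖(-1 : ℂ)‖₊ * (C₁ * K))
  exact_mod_cast this

end Multiplier

/-! ### Density of the formal powers: the inductive step -/

section Density

variable {α β : ℝ} {p : ℝ≥0∞} {a : ℝ → ℝ} {x₀ : ℝ}

/-- The complex linear span of the formal powers. -/
def formalPowerSpan (a : ℝ → ℝ) (x₀ : ℝ) : Submodule ℂ (ℝ → ℂ) :=
  Submodule.span ℂ (range fun k x => (formalPower a x₀ k x : ℂ))

/-- Every function of class `W^{m,p}(α, β)` is a limit of combinations of formal powers. -/
def FormalPowersDense (α β : ℝ) (p : ℝ≥0∞) (m : ℕ) (a : ℝ → ℝ) (x₀ : ℝ) : Prop :=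
  ∀ (δ : ℝ≥0) (u : ℝ → ℂ), SobolevBound α β p m δ u → ∀ ε : ℝ≥0, 0 < ε →
    ∃ s ∈ formalPowerSpan a x₀, SobolevBound α β p m ε (fun x => u x - s x)

lemma IsPrimitiveOn.ofReal {u v : ℝ → ℝ} (hu : IsPrimitiveOn α β u v) :
    IsPrimitiveOn α β (fun x => (u x : ℂ)) (fun x => (v x : ℂ)) := by
  refine ⟨⟨hu.1.1.ofReal, hu.1.2.ofReal⟩, fun x hx => ?_⟩
  rw [intervalIntegral.integral_ofReal, ← Complex.ofReal_add, ← hu.2 x hx]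

lemma continuousOn_of_mem_formalPowerSpan (h : α ≤ β) (hx₀ : x₀ ∈ Icc α β)
    (ha : IsProperImpedance α β a) {s : ℝ → ℂ} (hs : s ∈ formalPowerSpan a x₀) :
    ContinuousOn s (Icc α β) := by
  induction hs using Submodule.span_induction with
  | mem x hx =>
    obtain ⟨k, rfl⟩ := hx
    exact Complex.continuous_ofReal.comp_continuousOn (formalPower_continuousOn h hx₀ ha k)
  | zero => exact continuousOn_const
  | add x y _ _ hx hy => exact hx.add hy
  | smul c x _ hx => exact hx.const_smul c

lemma exists_isPrimitiveOn_of_mem_formalPowerSpan (h : α ≤ β) (hx₀ : x₀ ∈ Icc α β)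
    (ha : IsProperImpedance α β a) {s : ℝ → ℂ} (hs : s ∈ formalPowerSpan (fun x => 1 / a x) x₀) :
    ∃ S ∈ formalPowerSpan a x₀,
      IsPrimitiveOn α β S (fun x => ((1 / a x ^ 2 : ℝ) : ℂ) * s x) := by
  induction hs using Submodule.span_induction with
  | mem x hx =>
    obtain ⟨k, rfl⟩ := hx
    refine ⟨((k : ℂ) + 1)⁻¹ • fun x => (formalPower a x₀ (k + 1) x : ℂ),
      Submodule.smul_mem _ _ (Submodule.subset_span ⟨_, rfl⟩), ?_⟩
    refine ((formalPower_isPrimitiveOn h hx₀ ha k).ofReal.const_mul ((k : ℂ) + 1)⁻¹).congr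
      (fun x _ => rfl) (Filter.Eventually.of_forall fun x => ?_) h
    have hk : (k : ℂ) + 1 ≠ 0 := Nat.cast_add_one_ne_zero k
    simp only
    push_cast
    rw [inv_mul_cancel_left₀ hk]
  | zero =>
    exact ⟨0, Submodule.zero_mem _, (IsPrimitiveOn.const (α := α) (β := β) (0 : ℂ)).congr
      (fun _ _ => rfl) (Filter.Eventually.of_forall fun x => by simp) h⟩
  | add u v _ _ ihu ihv =>
    obtain ⟨U, hU, pU⟩ := ihu
    obtain ⟨V, hV, pV⟩ := ihv
    exact ⟨U + V, Submodule.add_mem _ hU hV, (pU.add h pV).congr (fun _ _ => rfl)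
      (Filter.Eventually.of_forall fun x => by simp only [Pi.add_apply, mul_add]) h⟩
  | smul c u _ ihu =>
    obtain ⟨U, hU, pU⟩ := ihu
    exact ⟨c • U, Submodule.smul_mem _ c hU, (pU.const_mul c).congr (fun _ _ => rfl)
      (Filter.Eventually.of_forall fun x => by
        simp only [Pi.smul_apply, smul_eq_mul, mul_left_comm _ c]) h⟩

lemma one_mem_formalPowerSpan (a : ℝ → ℝ) (x₀ : ℝ) : (fun _ => 1) ∈ formalPowerSpan a x₀ :=
  Submodule.subset_span ⟨0, by simp [formalPower]⟩

/-- Differentiation followed by multiplication with `a ^ 2` reduces the density of the formal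
powers of `a` in `W^{m+1,p}` to that of the formal powers of `1 / a` in `W^{m,p}`. -/
lemma FormalPowersDense.succ (h : α ≤ β) (hx₀ : x₀ ∈ Icc α β)
    (ha : IsProperImpedance α β a) {m : ℕ}
    (h1 : IsSobolevMultiplier α β p m (fun x => ((a x ^ 2 : ℝ) : ℂ)))
    (h2 : IsSobolevMultiplier α β p m (fun x => ((1 / a x ^ 2 : ℝ) : ℂ)))
    (hd : FormalPowersDense α β p m (fun x => 1 / a x) x₀) :
    FormalPowersDense α β p (m + 1) a x₀ := by
  intro δ u hu ε hε
  obtain ⟨U, v, pU, -, hv, hae⟩ := hu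
  obtain ⟨C₁, hC₁⟩ := h1
  obtain ⟨C₂, hC₂⟩ := h2
  obtain ⟨s, hs, hsε⟩ := hd _ _ (hC₁ δ v hv) (ε / (C₂ + 1)) (by positivity)
  obtain ⟨S, hS, pS⟩ := exists_isPrimitiveOn_of_mem_formalPowerSpan h hx₀ ha hs
  refine ⟨S + (U α - S α) • fun _ => 1, Submodule.add_mem _ hS
    (Submodule.smul_mem _ _ (one_mem_formalPowerSpan a x₀)), ?_⟩
  have pD := (pU.add h ((pS.add h (IsPrimitiveOn.const (U α - S α))).const_mul (-1)))
  refine ⟨_, _, pD, ?_, ((hC₂ _ _ hsε).mono ?_).congr ?_, ?_⟩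
  · simp
  · rw [mul_div_assoc', div_le_iff₀ (by positivity), mul_comm]
    exact mul_le_mul_right (le_add_of_nonneg_right zero_le) _
  · filter_upwards [ha.pos] with x hx
    have hx' : (a x : ℂ) ≠ 0 := by exact_mod_cast hx.ne'
    push_cast
    field_simp
    ring
  · filter_upwards [hae] with x hx
    simp only [hx, Pi.add_apply, Pi.smul_apply, smul_eq_mul, mul_one]
    ring

/-- The formal powers themselves are of class `W^{m,p}`. -/
lemma exists_sobolevBound_formalPower (h : α ≤ β) (hx₀ : x₀ ∈ Icc α β)
    (ha : IsProperImpedance α β a) (m : ℕ)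
    (h1 : ∀ j < m, IsSobolevMultiplier α β p j (fun x => ((a x ^ 2 : ℝ) : ℂ)))
    (h2 : ∀ j < m, IsSobolevMultiplier α β p j (fun x => ((1 / a x ^ 2 : ℝ) : ℂ))) (k : ℕ) :
    ∃ K, SobolevBound α β p m K (fun x => (formalPower a x₀ k x : ℂ)) := by
  induction m generalizing a k with
  | zero =>
    have hc := continuousOn_of_mem_formalPowerSpan h hx₀ ha
      (Submodule.subset_span ⟨k, rfl⟩ : (fun x => (formalPower a x₀ k x : ℂ)) ∈ formalPowerSpan a x₀)
    obtain ⟨M, hM⟩ := isCompact_Icc.exists_bound_of_continuousOn hc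
    obtain ⟨C, hC⟩ := eLpNorm_le_of_norm_le p α β
    refine ⟨C * M.toNNReal, (hc.mono Ioo_subset_Icc_self).aestronglyMeasurable measurableSet_Ioo,
      hC _ _ (ae_Ioo_of_ae_Icc fun x hx => (hM x hx).trans (Real.le_coe_toNNReal M))⟩
  | succ m ih =>
    rcases k with _ | k
    · have h0 : ∀ j, SobolevBound α β p j 0 (fun _ => 0) := by
        intro j
        induction j with
        | zero => exact ⟨aestronglyMeasurable_const, by simp⟩
        | succ j ihj => exact ⟨_, _, IsPrimitiveOn.const 0, by simp, ihj, Filter.EventuallyEq.rfl⟩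
      exact ⟨1, _, _, IsPrimitiveOn.const 1, by simp, (h0 m).mono zero_le,
        Filter.Eventually.of_forall fun x => by simp [formalPower]⟩
    · obtain ⟨K, hK⟩ := ih ha.inv (fun j hj => by simpa using h2 j (hj.trans (Nat.lt_succ_self m)))
        (fun j hj => by simpa using h1 j (hj.trans (Nat.lt_succ_self m))) k
      obtain ⟨C, hC⟩ := h2 m (Nat.lt_succ_self m)
      have hv := (hC K _ hK).const_mul ((k : ℂ) + 1)
      refine ⟨max ‖(formalPower a x₀ (k + 1) α : ℂ)‖₊ (‖(k : ℂ) + 1‖₊ * (C * K)), _, _,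
        (formalPower_isPrimitiveOn h hx₀ ha k).ofReal, ?_,
        (hv.mono (le_max_right _ _)).congr (Filter.Eventually.of_forall fun x => by
          push_cast; ring), Filter.EventuallyEq.rfl⟩
      have := le_max_left ‖(formalPower a x₀ (k + 1) α : ℂ)‖₊ (‖(k : ℂ) + 1‖₊ * (C * K))
      exact_mod_cast this

lemma FormalPowersDense.of_zero (h : α ≤ β) (hx₀ : x₀ ∈ Icc α β)
    (ha : IsProperImpedance α β a) (m : ℕ)
    (h1 : ∀ j < m, IsSobolevMultiplier α β p j (fun x => ((a x ^ 2 : ℝ) : ℂ)))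
    (h2 : ∀ j < m, IsSobolevMultiplier α β p j (fun x => ((1 / a x ^ 2 : ℝ) : ℂ)))
    (hd : FormalPowersDense α β p 0 a x₀)
    (hd' : FormalPowersDense α β p 0 (fun x => 1 / a x) x₀) :
    FormalPowersDense α β p m a x₀ := by
  induction m generalizing a with
  | zero => exact hd
  | succ m ih =>
    refine FormalPowersDense.succ h hx₀ ha (h1 m (Nat.lt_succ_self m))
      (h2 m (Nat.lt_succ_self m)) (ih ha.inv ?_ ?_ hd' (by rwa [one_div_one_div_fun]))
    · exact fun j hj => by simpa using h2 j (hj.trans (Nat.lt_succ_self m))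
    · exact fun j hj => by simpa using h1 j (hj.trans (Nat.lt_succ_self m))

end Density

/-! ### Weak derivatives and primitives -/

section WeakDerivative

variable {α β : ℝ} {p : ℝ≥0∞} {E : Type*} [NormedAddCommGroup E] [NormedSpace ℝ E]

lemma iteratedDeriv_testFunction {φ : ℝ → ℝ} (h1 : ContDiff ℝ ∞ φ) (h2 : HasCompactSupport φ)
    (h3 : tsupport φ ⊆ Ioo α β) (k : ℕ) :
    ContDiff ℝ ∞ (iteratedDeriv k φ) ∧ HasCompactSupport (iteratedDeriv k φ) ∧
      tsupport (iteratedDeriv k φ) ⊆ Ioo α β := by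
  induction k with
  | zero => simpa using ⟨h1, h2, h3⟩
  | succ k ih =>
    obtain ⟨i1, i2, i3⟩ := ih
    rw [iteratedDeriv_succ]
    exact ⟨((contDiff_infty_iff_deriv).1 i1).2, i2.deriv, (tsupport_deriv_subset).trans i3⟩

lemma IsPrimitiveOn.of_contDiff {f : ℝ → E} [CompleteSpace E] (hf : ContDiff ℝ 1 f) :
    IsPrimitiveOn α β f (deriv f) := by
  have hc : Continuous (deriv f) := hf.continuous_deriv le_rfl
  refine ⟨hc.intervalIntegrable _ _, fun x _ => ?_⟩
  rw [intervalIntegral.integral_deriv_eq_sub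
    (fun t _ => (hf.differentiable one_ne_zero).differentiableAt) (hc.intervalIntegrable _ _)]
  abel

lemma integral_deriv_smul_eq_neg [CompleteSpace E] (h : α ≤ β) {u U v : ℝ → E}
    (hU : IsPrimitiveOn α β U v)
    (huU : u =ᵐ[volume.restrict (Ioo α β)] U) {φ : ℝ → ℝ} (h1 : ContDiff ℝ ∞ φ)
    (h3 : tsupport φ ⊆ Ioo α β) :
    ∫ x in Ioo α β, deriv φ x • u x = - ∫ x in Ioo α β, φ x • v x := by
  have hφ : IsPrimitiveOn α β φ (deriv φ) :=
    IsPrimitiveOn.of_contDiff (h1.of_le (by exact_mod_cast le_top))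
  have hα : φ α = 0 := image_eq_zero_of_notMem_tsupport fun hc => (lt_irrefl _ (h3 hc).1)
  have hβ : φ β = 0 := image_eq_zero_of_notMem_tsupport fun hc => (lt_irrefl _ (h3 hc).2)
  have hP := (hφ.smul h hU).integral_eq (left_mem_Icc.2 h) (right_mem_Icc.2 h)
  have c1 := hφ.continuousOn
  have c2 := hU.continuousOn
  rw [← uIcc_of_le h] at c1 c2
  rw [intervalIntegral.integral_add (hφ.1.smul_continuousOn c2) (hU.1.continuousOn_smul c1),
    hα, hβ, zero_smul, zero_smul, sub_zero, intervalIntegral_eq_integral_Ioo h,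
    intervalIntegral_eq_integral_Ioo h] at hP
  rw [← eq_neg_of_add_eq_zero_left hP]
  exact integral_congr_ae (huU.mono fun x hx => by simp only [hx])

lemma IsWeakDeriv.congr {k : ℕ} {u v u' v' : ℝ → E} (hw : IsWeakDeriv α β k u v)
    (hu : u' =ᵐ[volume.restrict (Ioo α β)] u) (hv : v' =ᵐ[volume.restrict (Ioo α β)] v) :
    IsWeakDeriv α β k u' v' := by
  intro φ h1 h2 h3
  rw [integral_congr_ae (hu.mono fun x hx => by simp only [hx] :
      (fun x => iteratedDeriv k φ x • u' x) =ᵐ[_] fun x => iteratedDeriv k φ x • u x),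
    integral_congr_ae (hv.mono fun x hx => by simp only [hx] :
      (fun x => φ x • v' x) =ᵐ[_] fun x => φ x • v x)]
  exact hw φ h1 h2 h3

lemma integrable_testFunction_smul {φ : ℝ → ℝ} (h1 : Continuous φ) (h2 : HasCompactSupport φ)
    {v : ℝ → E} (hv : Integrable v (volume.restrict (Ioo α β))) :
    Integrable (fun x => φ x • v x) (volume.restrict (Ioo α β)) := by
  obtain ⟨C, hC⟩ := h2.exists_bound_of_continuous h1
  exact hv.bdd_smul C h1.aestronglyMeasurable (Filter.Eventually.of_forall hC)

/-- The fundamental lemma of the calculus of variations on `(α, β)`. -/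
lemma ae_eq_of_integral_testFunction_smul_eq [CompleteSpace E] {v v' : ℝ → E}
    (hv : Integrable v (volume.restrict (Ioo α β)))
    (hv' : Integrable v' (volume.restrict (Ioo α β)))
    (h : ∀ φ : ℝ → ℝ, ContDiff ℝ ∞ φ → HasCompactSupport φ → tsupport φ ⊆ Ioo α β →
      ∫ x in Ioo α β, φ x • v x = ∫ x in Ioo α β, φ x • v' x) :
    v =ᵐ[volume.restrict (Ioo α β)] v' := by
  have h0 := isOpen_Ioo.ae_eq_zero_of_integral_contDiff_smul_eq_zero (μ := volume)
    (f := fun x => v x - v' x) (U := Ioo α β)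
    (show IntegrableOn (v - v') (Ioo α β) volume from hv.sub hv').locallyIntegrableOn
    (fun φ h1 h2 h3 => by
      have e : ∫ x, φ x • (v x - v' x) = ∫ x in Ioo α β, φ x • (v x - v' x) := by
        symm
        refine setIntegral_eq_integral_of_forall_compl_eq_zero fun x hx => ?_
        rw [image_eq_zero_of_notMem_tsupport fun hc => hx (h3 hc), zero_smul]
      rw [e]
      simp only [smul_sub]
      rw [integral_sub (integrable_testFunction_smul h1.continuous h2 hv)
        (integrable_testFunction_smul h1.continuous h2 hv'), h φ h1 h2 h3, sub_self])
  rw [Filter.EventuallyEq, ae_restrict_iff' measurableSet_Ioo]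
  exact h0.mono fun x hx hx' => sub_eq_zero.1 (hx hx')

lemma IsWeakDeriv.ae_unique [CompleteSpace E] {k : ℕ} {u v v' : ℝ → E}
    (hw : IsWeakDeriv α β k u v) (hw' : IsWeakDeriv α β k u v')
    (hv : Integrable v (volume.restrict (Ioo α β)))
    (hv' : Integrable v' (volume.restrict (Ioo α β))) :
    v =ᵐ[volume.restrict (Ioo α β)] v' := by
  refine ae_eq_of_integral_testFunction_smul_eq hv hv' fun φ h1 h2 h3 => ?_
  have e := (hw φ h1 h2 h3).symm.trans (hw' φ h1 h2 h3)
  exact smul_right_injective E (pow_ne_zero k (by norm_num : (-1 : ℝ) ≠ 0)) e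

/-- A test function with vanishing integral is the derivative of a test function. -/
lemma exists_testFunction_deriv_eq {θ : ℝ → ℝ} (hαβ : α < β) (h1 : ContDiff ℝ ∞ θ)
    (h2 : HasCompactSupport θ)
    (h3 : tsupport θ ⊆ Ioo α β) (h0 : ∫ x, θ x = 0) :
    ∃ χ : ℝ → ℝ, ContDiff ℝ ∞ χ ∧ HasCompactSupport χ ∧ tsupport χ ⊆ Ioo α β ∧ deriv χ = θ := by
  obtain ⟨l, hl, hlK⟩ : ∃ l, α < l ∧ ∀ x ∈ tsupport θ, l ≤ x := by
    rcases (tsupport θ).eq_empty_or_nonempty with he | hne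
    · exact ⟨β, hαβ, by simp [he]⟩
    · obtain ⟨l, hl⟩ := h2.isCompact.exists_isLeast hne
      exact ⟨l, (h3 hl.1).1, hl.2⟩
  obtain ⟨r, hr, hrK⟩ : ∃ r, r < β ∧ ∀ x ∈ tsupport θ, x ≤ r := by
    rcases (tsupport θ).eq_empty_or_nonempty with he | hne
    · exact ⟨α, hαβ, by simp [he]⟩
    · obtain ⟨l, hl⟩ := h2.isCompact.exists_isGreatest hne
      exact ⟨l, (h3 hl.1).2, hl.2⟩
  have hd : ∀ x, HasDerivAt (fun x => ∫ t in α..x, θ t) (θ x) x := fun x =>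
    intervalIntegral.integral_hasDerivAt_right (h1.continuous.intervalIntegrable _ _)
      (h1.continuous.stronglyMeasurableAtFilter _ _) h1.continuous.continuousAt
  have hderiv : deriv (fun x => ∫ t in α..x, θ t) = θ := funext fun x => (hd x).deriv
  have hsupp : Function.support (fun x => ∫ t in α..x, θ t) ⊆ Icc l r := by
    intro x hx
    by_contra hcon
    apply hx
    rw [mem_Icc, not_and_or, not_le, not_le] at hcon
    rcases hcon with hxl | hxr
    · have : ∀ t ∈ uIcc α x, θ t = 0 := fun t ht =>
        image_eq_zero_of_notMem_tsupport fun hc =>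
          absurd (hlK t hc) (not_le.2 (ht.2.trans_lt (max_lt hl hxl)))
      simp only
      rw [intervalIntegral.integral_congr this]
      simp
    · simp only
      rcases le_or_gt x α with hxα | hxα
      · have : ∀ t ∈ uIcc α x, θ t = 0 := fun t ht =>
          image_eq_zero_of_notMem_tsupport fun hc => by
            rw [uIcc_of_ge hxα] at ht
            exact absurd (h3 hc).1 (not_lt.2 ht.2)
        rw [intervalIntegral.integral_congr this]
        simp
      · rw [intervalIntegral.integral_eq_integral_of_support_subset, h0]
        intro t ht
        have ht' := subset_tsupport θ ht
        exact ⟨(h3 ht').1, (hrK t ht').trans hxr.le⟩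
  have hts : tsupport (fun x => ∫ t in α..x, θ t) ⊆ Icc l r :=
    closure_minimal hsupp isClosed_Icc
  refine ⟨fun x => ∫ t in α..x, θ t, ?_, ?_, hts.trans (Icc_subset_Ioo hl hr), hderiv⟩
  · rw [contDiff_infty_iff_deriv, hderiv]
    exact ⟨fun x => (hd x).differentiableAt, h1⟩
  · exact isCompact_Icc.of_isClosed_subset (isClosed_tsupport _) hts

lemma exists_testFunction_integral_eq_one (h : α < β) :
    ∃ ψ : ℝ → ℝ, ContDiff ℝ ∞ ψ ∧ HasCompactSupport ψ ∧ tsupport ψ ⊆ Ioo α β ∧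
      ∫ x, ψ x = 1 := by
  let f : ContDiffBump ((α + β) / 2) := ⟨(β - α) / 8, (β - α) / 4, by linarith, by linarith⟩
  refine ⟨f.normed volume, f.contDiff_normed, f.hasCompactSupport_normed, ?_, f.integral_normed⟩
  rw [f.tsupport_normed_eq, Real.closedBall_eq_Icc]
  exact Icc_subset_Ioo (by change α < (α + β) / 2 - (β - α) / 4; linarith)
    (by change (α + β) / 2 + (β - α) / 4 < β; linarith)

/-- The du Bois-Reymond lemma: a function with an integrable weak derivative is a primitive of it
almost everywhere. -/
lemma IsWeakDeriv.exists_isPrimitiveOn [CompleteSpace E] (h : α < β) {u v : ℝ → E}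
    (hw : IsWeakDeriv α β 1 u v) (hu : Integrable u (volume.restrict (Ioo α β)))
    (hv : Integrable v (volume.restrict (Ioo α β))) :
    ∃ U, IsPrimitiveOn α β U v ∧ u =ᵐ[volume.restrict (Ioo α β)] U := by
  have hv' := (intervalIntegrable_iff_integrable_Ioo h.le).2 hv
  set P : ℝ → E := fun x => ∫ t in α..x, v t
  have hP : IsPrimitiveOn α β P v := IsPrimitiveOn.of_integral' h.le hv' (left_mem_Icc.2 h.le)
  have hPi : Integrable P (volume.restrict (Ioo α β)) :=
    (intervalIntegrable_iff_integrable_Ioo h.le).1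
      (ContinuousOn.intervalIntegrable (by rw [uIcc_of_le h.le]; exact hP.continuousOn))
  have hri : Integrable (fun x => u x - P x) (volume.restrict (Ioo α β)) := hu.sub hPi
  have hr : ∀ φ : ℝ → ℝ, ContDiff ℝ ∞ φ → HasCompactSupport φ → tsupport φ ⊆ Ioo α β →
      ∫ x in Ioo α β, deriv φ x • (u x - P x) = 0 := by
    intro φ h1 h2 h3
    have e1 := hw φ h1 h2 h3
    have e2 := integral_deriv_smul_eq_neg h.le hP Filter.EventuallyEq.rfl h1 h3
    have c1 := (iteratedDeriv_testFunction h1 h2 h3 1)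
    rw [iteratedDeriv_one] at e1 c1
    simp only [smul_sub]
    rw [integral_sub (integrable_testFunction_smul c1.1.continuous c1.2.1 hu)
      (integrable_testFunction_smul c1.1.continuous c1.2.1 hPi), e1, e2]
    simp
  obtain ⟨ψ, p1, p2, p3, p4⟩ := exists_testFunction_integral_eq_one h
  set c : E := ∫ x in Ioo α β, ψ x • (u x - P x) with hc
  have key : (fun x => u x - P x) =ᵐ[volume.restrict (Ioo α β)] fun _ => c := by
    refine ae_eq_of_integral_testFunction_smul_eq hri (integrable_const c) fun φ h1 h2 h3 => ?_
    have hsub : tsupport (fun x => φ x - (∫ y, φ y) * ψ x) ⊆ tsupport φ ∪ tsupport ψ := by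
      refine closure_minimal (fun x hx => ?_) ((isClosed_tsupport _).union (isClosed_tsupport _))
      by_contra hcon
      rw [mem_union, not_or] at hcon
      apply hx
      simp only
      rw [image_eq_zero_of_notMem_tsupport hcon.1, image_eq_zero_of_notMem_tsupport hcon.2]
      simp
    have iφ : Integrable φ := h1.continuous.integrable_of_hasCompactSupport h2
    have iψ : Integrable ψ := p1.continuous.integrable_of_hasCompactSupport p2
    obtain ⟨χ, x1, x2, x3, x4⟩ := exists_testFunction_deriv_eq
      (θ := fun x => φ x - (∫ y, φ y) * ψ x) h (h1.sub (contDiff_const.mul p1))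
      ((h2.isCompact.union p2.isCompact).of_isClosed_subset (isClosed_tsupport _) hsub)
      (hsub.trans (union_subset h3 p3))
      (by rw [integral_sub iφ (iψ.const_mul _), integral_const_mul, p4, mul_one, sub_self])
    have e := hr χ x1 x2 x3
    rw [x4] at e
    simp only [sub_smul, mul_smul] at e
    have i2 : Integrable (fun x => (∫ y, φ y) • ψ x • (u x - P x)) (volume.restrict (Ioo α β)) :=
      (integrable_testFunction_smul p1.continuous p2 hri).smul (∫ y, φ y)
    rw [integral_sub (integrable_testFunction_smul h1.continuous h2 hri) i2, integral_smul, ← hc,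
      sub_eq_zero] at e
    rw [e, integral_smul_const]
    congr 1
    symm
    refine setIntegral_eq_integral_of_forall_compl_eq_zero fun x hx => ?_
    exact image_eq_zero_of_notMem_tsupport fun hc => hx (h3 hc)
  refine ⟨fun x => c + P x, ?_, ?_⟩
  · exact (IsPrimitiveOn.of_integral h.le hv' (left_mem_Icc.2 h.le) c)
  · filter_upwards [key] with x hx
    rw [← hx]
    abel

end WeakDerivative

/-! ### The quantitative classes and the Sobolev space -/

section SobolevSpace

variable {α β : ℝ} {p : ℝ≥0∞}

lemma MemSobolev.exists_sobolevBound (hp : 1 ≤ p) (h : α < β) {m : ℕ} {u : ℝ → ℂ}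
    (hu : MemSobolev α β m p u) : ∃ δ, SobolevBound α β p m δ u := by
  induction m generalizing u with
  | zero =>
    refine ⟨(eLpNorm u p (volume.restrict (Ioo α β))).toNNReal, hu.1.1, ?_⟩
    rw [ENNReal.coe_toNNReal hu.1.2.ne]
  | succ m ih =>
    obtain ⟨v, hv, hw⟩ := hu.2 1 le_rfl (by omega)
    have hv' : MemSobolev α β m p v := by
      refine ⟨hv, fun k hk hkm => ?_⟩
      obtain ⟨w, hw1, hw2⟩ := hu.2 (k + 1) (by omega) (by omega)
      refine ⟨w, hw1, fun φ h1 h2 h3 => ?_⟩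
      obtain ⟨i1, i2, i3⟩ := iteratedDeriv_testFunction h1 h2 h3 k
      have e1 := hw _ i1 i2 i3
      have e2 := hw2 φ h1 h2 h3
      rw [iteratedDeriv_one, ← iteratedDeriv_succ, e2] at e1
      simp only [pow_succ, pow_zero, mul_neg, mul_one, neg_smul, one_smul, neg_inj] at e1
      exact e1.symm
    obtain ⟨δ, hδ⟩ := ih hv'
    obtain ⟨U, hU, huU⟩ := hw.exists_isPrimitiveOn h (hu.1.integrable hp) (hv.integrable hp)
    refine ⟨max ‖U α‖₊ δ, U, v, hU, ?_, hδ.mono (le_max_right _ _), huU⟩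
    have := le_max_left ‖U α‖₊ δ
    exact_mod_cast this

lemma SobolevBound.exists_isWeakDeriv (hp : 1 ≤ p) (h : α ≤ β) {m k : ℕ} (hk : k ≤ m) :
    ∃ C : ℝ≥0, ∀ (δ : ℝ≥0) (u : ℝ → ℂ), SobolevBound α β p m δ u →
      ∃ v, AEStronglyMeasurable v (volume.restrict (Ioo α β)) ∧
        eLpNorm v p (volume.restrict (Ioo α β)) ≤ (C * δ : ℝ≥0) ∧ IsWeakDeriv α β k u v := by
  induction k generalizing m with
  | zero =>
    obtain ⟨C, hC⟩ := SobolevBound.exists_eLpNorm_le (α := α) (β := β) hp h m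
    exact ⟨C, fun δ u hu => ⟨u, (hC δ u hu).1, (hC δ u hu).2, fun φ _ _ _ => by simp⟩⟩
  | succ k ih =>
    obtain ⟨m, rfl⟩ : ∃ n, m = n + 1 := ⟨m - 1, by omega⟩
    obtain ⟨C, hC⟩ := ih (m := m) (by omega)
    refine ⟨C, fun δ u hu => ?_⟩
    obtain ⟨U, w, hU, -, hw, huU⟩ := hu
    obtain ⟨v, hv1, hv2, hv3⟩ := hC δ w hw
    refine ⟨v, hv1, hv2, fun φ h1 h2 h3 => ?_⟩
    obtain ⟨i1, i2, i3⟩ := iteratedDeriv_testFunction h1 h2 h3 k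
    rw [iteratedDeriv_succ, integral_deriv_smul_eq_neg h hU huU i1 i3, hv3 φ h1 h2 h3, pow_succ]
    simp

lemma MemSobolev.ofReal {m : ℕ} {u : ℝ → ℝ} (hu : MemSobolev α β m p u) :
    MemSobolev α β m p (fun x => (u x : ℂ)) := by
  refine ⟨hu.1.ofReal, fun k h1 h2 => ?_⟩
  obtain ⟨v, hv, hw⟩ := hu.2 k h1 h2
  refine ⟨fun x => (v x : ℂ), hv.ofReal, fun φ h1 h2 h3 => ?_⟩
  have e := congrArg (fun r : ℝ => (r : ℂ)) (hw φ h1 h2 h3)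
  simp only [smul_eq_mul, Complex.real_smul, ← Complex.ofReal_mul] at e ⊢
  rw [integral_complex_ofReal, integral_complex_ofReal, e, Complex.ofReal_mul]

variable [Fact (1 ≤ p)]

lemma SobolevBound.exists_mem_sobolevSpace (h : α ≤ β) {m : ℕ} {δ : ℝ≥0} {u : ℝ → ℂ}
    (hu : SobolevBound α β p m δ u) :
    ∃ G : sobolevSpace α β m p, ((G : Fin (m + 1) → Lp ℂ p (volume.restrict (Ioo α β))) 0 : ℝ → ℂ)
      =ᵐ[volume.restrict (Ioo α β)] u := by
  have hex : ∀ k : Fin (m + 1), ∃ v : ℝ → ℂ, MemLp v p (volume.restrict (Ioo α β)) ∧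
      IsWeakDeriv α β k u v ∧ (k = 0 → v = u) := by
    intro k
    obtain ⟨C, hC⟩ := SobolevBound.exists_isWeakDeriv (p := p) (α := α) (β := β) Fact.out h
      (Nat.lt_succ_iff.1 k.2)
    obtain ⟨v, h1, h2, h3⟩ := hC δ u hu
    rcases eq_or_ne k 0 with rfl | hk
    · obtain ⟨C, hC⟩ := SobolevBound.exists_eLpNorm_le (p := p) (α := α) (β := β) Fact.out h m
      exact ⟨u, ⟨(hC δ u hu).1, (hC δ u hu).2.trans_lt ENNReal.coe_lt_top⟩,
        fun φ _ _ _ => by simp, fun _ => rfl⟩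
    · exact ⟨v, ⟨h1, h2.trans_lt ENNReal.coe_lt_top⟩, h3, fun h0 => absurd h0 hk⟩
  choose v h1 h2 h3 using hex
  have h0 : ((h1 0).toLp (v 0) : ℝ → ℂ) =ᵐ[volume.restrict (Ioo α β)] u :=
    (h1 0).coeFn_toLp.trans (by rw [h3 0 rfl])
  exact ⟨⟨fun k => (h1 k).toLp (v k), fun k => (h2 k).congr h0 (h1 k).coeFn_toLp⟩, h0⟩

lemma exists_norm_le_of_sobolevBound (h : α ≤ β) (m : ℕ) :
    ∃ C : ℝ≥0, ∀ (δ : ℝ≥0) (G : sobolevSpace α β m p),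
      SobolevBound α β p m δ ((G : Fin (m + 1) → Lp ℂ p (volume.restrict (Ioo α β))) 0) →
      ‖G‖ ≤ C * δ := by
  have hex : ∀ k : Fin (m + 1), _ := fun k =>
    SobolevBound.exists_isWeakDeriv (p := p) (α := α) (β := β) Fact.out h (Nat.lt_succ_iff.1 k.2)
  choose C hC using hex
  refine ⟨∑ k, C k, fun δ G hG => ?_⟩
  rw [Submodule.coe_norm, pi_norm_le_iff_of_nonneg (by positivity)]
  intro k
  obtain ⟨v, h1, h2, h3⟩ := hC k δ _ hG
  have hp : 1 ≤ p := Fact.out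
  have hv : MemLp v p (volume.restrict (Ioo α β)) := ⟨h1, h2.trans_lt ENNReal.coe_lt_top⟩
  have hae := (G.2 k).ae_unique h3 ((Lp.memLp _).integrable hp) (hv.integrable hp)
  rw [Lp.norm_def, eLpNorm_congr_ae hae]
  have h4 := ENNReal.toReal_mono ENNReal.coe_ne_top h2
  refine h4.trans ?_
  have h5 : C k * δ ≤ (∑ k, C k) * δ :=
    mul_le_mul_left (Finset.single_le_sum (fun _ _ => zero_le) (Finset.mem_univ k)) _
  exact_mod_cast h5

lemma FormalPowersDense.isCompleteInSobolev (h : α < β) {a : ℝ → ℝ} {x₀ : ℝ} {m : ℕ}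
    (hmem : ∀ k, ∃ K, SobolevBound α β p m K (fun x => (formalPower a x₀ k x : ℂ)))
    (hd : FormalPowersDense α β p m a x₀) :
    IsCompleteInSobolev α β m p (fun k x => (formalPower a x₀ k x : ℂ)) := by
  have hp : 1 ≤ p := Fact.out
  have hF : ∀ k, ∃ G : sobolevSpace α β m p, _ := fun k =>
    (hmem k).choose_spec.exists_mem_sobolevSpace h.le
  choose F hF using hF
  refine ⟨F, hF, fun G => ?_⟩
  obtain ⟨C, hC⟩ := exists_norm_le_of_sobolevBound (p := p) h.le m
  have hlift : ∀ s ∈ formalPowerSpan a x₀, ∃ S ∈ Submodule.span ℂ (range F),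
      ((S : Fin (m + 1) → Lp ℂ p (volume.restrict (Ioo α β))) 0 : ℝ → ℂ)
        =ᵐ[volume.restrict (Ioo α β)] s := by
    intro s hs
    induction hs using Submodule.span_induction with
    | mem x hx => obtain ⟨k, rfl⟩ := hx; exact ⟨F k, Submodule.subset_span ⟨k, rfl⟩, hF k⟩
    | zero => exact ⟨0, Submodule.zero_mem _, Lp.coeFn_zero _ _ _⟩
    | add u v _ _ ihu ihv =>
      obtain ⟨U, hU, eU⟩ := ihu
      obtain ⟨V, hV, eV⟩ := ihv
      exact ⟨U + V, Submodule.add_mem _ hU hV, (Lp.coeFn_add _ _).trans (eU.add eV)⟩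
    | smul c u _ ihu =>
      obtain ⟨U, hU, eU⟩ := ihu
      exact ⟨c • U, Submodule.smul_mem _ c hU, (Lp.coeFn_smul _ _).trans (eU.const_smul c)⟩
  have hG : MemSobolev α β m p
      ((G : Fin (m + 1) → Lp ℂ p (volume.restrict (Ioo α β))) 0 : ℝ → ℂ) :=
    ⟨Lp.memLp _, fun k _ hk => ⟨_, Lp.memLp _, G.2 ⟨k, Nat.lt_succ_of_le hk⟩⟩⟩
  obtain ⟨δ, hδ⟩ := hG.exists_sobolevBound hp h
  rw [Metric.mem_closure_iff]
  intro ε hε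
  obtain ⟨s, hs, hsε⟩ := hd δ _ hδ (⟨ε, hε.le⟩ / (2 * (C + 1))) 
    (div_pos (show (0 : ℝ≥0) < ⟨ε, hε.le⟩ from hε) (by positivity))
  obtain ⟨S, hS, eS⟩ := hlift s hs
  refine ⟨S, hS, ?_⟩
  rw [dist_eq_norm]
  have hb := hC _ (G - S) (hsε.congr ((Lp.coeFn_sub _ _).trans (Filter.EventuallyEq.rfl.sub eS)))
  refine hb.trans_lt ?_
  change (C : ℝ) * (ε / (2 * (C + 1))) < ε
  rw [mul_div_assoc', div_lt_iff₀ (by positivity)]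
  nlinarith [C.2, mul_nonneg C.2 hε.le, NNReal.coe_nonneg C]

end SobolevSpace

/-! ### Density of the formal powers in `L²` and in `L^p` -/

section BaseCase

variable {α β : ℝ} {p : ℝ≥0∞} {a : ℝ → ℝ} {x₀ : ℝ}

/-- The formal powers of a proper impedance are complete in `L²`. -/
lemma formalPowersDense_two_zero (h : α < β) (hx₀ : x₀ ∈ Icc α β)
    (ha : IsProperImpedance α β a) : FormalPowersDense α β 2 0 a x₀ := by
  have hΦ : ∀ k, MemLp (fun x => (formalPower a x₀ k x : ℂ)) 2 (volume.restrict (Ioo α β)) := by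
    intro k
    obtain ⟨K, hK⟩ := exists_sobolevBound_formalPower (p := 2) h.le hx₀ ha 0
      (by simp) (by simp) k
    exact ⟨hK.1, hK.2.trans_lt ENNReal.coe_lt_top⟩
  set Φ : ℕ → Lp ℂ 2 (volume.restrict (Ioo α β)) := fun k => (hΦ k).toLp _ with hΦdef
  have hperp : (Submodule.span ℂ (range Φ))ᗮ = ⊥ := by
    rw [Submodule.eq_bot_iff]
    intro g hg
    have hgi : Integrable g (volume.restrict (Ioo α β)) := (Lp.memLp g).integrable one_le_two
    have hgφ : ∀ k, ∫ x in Ioo α β, g x * (formalPower a x₀ k x : ℂ) = 0 := by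
      intro k
      have h1 := (Submodule.mem_orthogonal _ g).1 hg (Φ k) (Submodule.subset_span ⟨k, rfl⟩)
      rw [L2.inner_def] at h1
      rw [← h1]
      refine integral_congr_ae ?_
      filter_upwards [(hΦ k).coeFn_toLp] with x hx
      rw [hΦdef]
      simp only [hx, RCLike.inner_apply, Complex.conj_ofReal]
    have hgφi : ∀ k, Integrable (fun x => g x * (formalPower a x₀ k x : ℂ))
        (volume.restrict (Ioo α β)) := fun k =>
      (intervalIntegrable_iff_integrable_Ioo h.le).1
        (((intervalIntegrable_iff_integrable_Ioo h.le).2 hgi).mul_continuousOn_Icc h.le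
          (Complex.continuous_ofReal.comp_continuousOn (formalPower_continuousOn h.le hx₀ ha k)))
    have hre : (fun x => (g x).re) =ᵐ[volume.restrict (Ioo α β)] fun _ => 0 := by
      refine ae_eq_zero_of_annihilates_formalPower h hx₀ ha
        ((intervalIntegrable_iff_integrable_Ioo h.le).2 hgi.re) fun k => ?_
      have h2 := Complex.reCLM.integral_comp_comm (hgφi k)
      rw [hgφ k] at h2
      rw [intervalIntegral_eq_integral_Ioo h.le]
      simpa using h2
    have him : (fun x => (g x).im) =ᵐ[volume.restrict (Ioo α β)] fun _ => 0 := by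
      refine ae_eq_zero_of_annihilates_formalPower h hx₀ ha
        ((intervalIntegrable_iff_integrable_Ioo h.le).2 hgi.im) fun k => ?_
      have h2 := Complex.imCLM.integral_comp_comm (hgφi k)
      rw [hgφ k] at h2
      rw [intervalIntegral_eq_integral_Ioo h.le]
      simpa using h2
    refine Lp.ext ?_
    filter_upwards [hre, him, Lp.coeFn_zero ℂ 2 (volume.restrict (Ioo α β))] with x h1 h2 h3
    rw [h3]
    exact Complex.ext h1 h2
  have hlift : ∀ S ∈ Submodule.span ℂ (range Φ), ∃ s ∈ formalPowerSpan a x₀,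
      (S : ℝ → ℂ) =ᵐ[volume.restrict (Ioo α β)] s := by
    intro S hS
    induction hS using Submodule.span_induction with
    | mem x hx =>
      obtain ⟨k, rfl⟩ := hx
      exact ⟨_, Submodule.subset_span ⟨k, rfl⟩, (hΦ k).coeFn_toLp⟩
    | zero => exact ⟨0, Submodule.zero_mem _, Lp.coeFn_zero _ _ _⟩
    | add u v _ _ ihu ihv =>
      obtain ⟨U, hU, eU⟩ := ihu
      obtain ⟨V, hV, eV⟩ := ihv
      exact ⟨U + V, Submodule.add_mem _ hU hV, (Lp.coeFn_add _ _).trans (eU.add eV)⟩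
    | smul c u _ ihu =>
      obtain ⟨U, hU, eU⟩ := ihu
      exact ⟨c • U, Submodule.smul_mem _ c hU, (Lp.coeFn_smul _ _).trans (eU.const_smul c)⟩
  intro δ u hu ε hε
  have hum : MemLp u 2 (volume.restrict (Ioo α β)) := ⟨hu.1, hu.2.trans_lt ENNReal.coe_lt_top⟩
  have htop := (Submodule.topologicalClosure_eq_top_iff (K := Submodule.span ℂ (range Φ))).2 hperp
  have hmem : hum.toLp u ∈ (Submodule.span ℂ (range Φ)).topologicalClosure := by
    rw [htop]; trivial
  rw [← SetLike.mem_coe, Submodule.topologicalClosure_coe, EMetric.mem_closure_iff] at hmem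
  obtain ⟨S, hS, hSε⟩ := hmem ε (by exact_mod_cast hε)
  obtain ⟨s, hs, hSs⟩ := hlift S hS
  refine ⟨s, hs, ?_⟩
  have hae : (hum.toLp u - S : ℝ → ℂ) =ᵐ[volume.restrict (Ioo α β)] fun x => u x - s x :=
    hum.coeFn_toLp.sub hSs
  refine ⟨(((Lp.aestronglyMeasurable _).sub (Lp.aestronglyMeasurable _)).congr hae), ?_⟩
  rw [Lp.edist_def, eLpNorm_congr_ae hae] at hSε
  exact hSε.le

/-- Uniform approximation of smooth functions, which follows from completeness in `W^{1,2}`,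
gives completeness in every `L^p` with `p < ∞`. -/
lemma formalPowersDense_zero (hp : 1 ≤ p) (hp' : p ≠ ⊤) (h : α < β) (hx₀ : x₀ ∈ Icc α β)
    (ha : IsProperImpedance α β a)
    (h1 : IsSobolevMultiplier α β 2 0 (fun x => ((a x ^ 2 : ℝ) : ℂ)))
    (h2 : IsSobolevMultiplier α β 2 0 (fun x => ((1 / a x ^ 2 : ℝ) : ℂ))) :
    FormalPowersDense α β p 0 a x₀ := by
  have hd := (formalPowersDense_two_zero h hx₀ ha.inv).succ h.le hx₀ ha h1 h2
  obtain ⟨C, hC⟩ := SobolevBound.exists_norm_le (p := 2) (α := α) (β := β) one_le_two h.le 0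
  obtain ⟨C₂, hC₂⟩ := eLpNorm_le_of_norm_le 2 α β
  obtain ⟨Cp, hCp⟩ := eLpNorm_le_of_norm_le p α β
  intro δ u hu ε hε
  have hum : MemLp u p (volume.restrict (Ioo α β)) := ⟨hu.1, hu.2.trans_lt ENNReal.coe_lt_top⟩
  have hε2 : (0 : ℝ) < ((ε / 2 : ℝ≥0) : ℝ) := by exact_mod_cast half_pos hε
  obtain ⟨g, -, hg, hgε⟩ := hum.exist_eLpNorm_sub_le hp' hp hε2
  rw [ENNReal.ofReal_coe_nnreal] at hgε
  have hg1 : ContDiff ℝ 1 g := hg.of_le (by exact_mod_cast le_top)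
  have hgP : IsPrimitiveOn α β g (deriv g) := IsPrimitiveOn.of_contDiff hg1
  have hgc : Continuous (deriv g) := hg1.continuous_deriv le_rfl
  obtain ⟨M, hM⟩ := isCompact_Icc.exists_bound_of_continuousOn
    (hgc.continuousOn (s := Icc α β))
  have hgS : SobolevBound α β 2 1 (max ‖g α‖₊ (C₂ * M.toNNReal)) g := by
    refine ⟨g, deriv g, hgP, ?_, ⟨hgc.aestronglyMeasurable, ?_⟩, Filter.EventuallyEq.rfl⟩
    · have := le_max_left ‖g α‖₊ (C₂ * M.toNNReal)
      exact_mod_cast this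
    · refine (hC₂ M.toNNReal (deriv g) (ae_Ioo_of_ae_Icc fun x hx =>
        (hM x hx).trans (Real.le_coe_toNNReal M))).trans ?_
      exact_mod_cast le_max_right _ _
  obtain ⟨s, hs, hsε⟩ := hd _ g hgS (ε / 2 / (Cp * C + 1)) (by positivity)
  refine ⟨s, hs, ?_⟩
  have hsm : AEStronglyMeasurable s (volume.restrict (Ioo α β)) :=
    ((continuousOn_of_mem_formalPowerSpan h.le hx₀ ha hs).mono
      Ioo_subset_Icc_self).aestronglyMeasurable measurableSet_Ioo
  have hgm : AEStronglyMeasurable g (volume.restrict (Ioo α β)) :=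
    hg.continuous.aestronglyMeasurable
  have hgs := hCp _ _ (hC _ _ hsε)
  have hsum : SobolevBound α β p 0 (ε / 2 + ε / 2) (fun x => (u x - g x) + (g x - s x)) := by
    refine SobolevBound.add hp h.le ⟨hu.1.sub hgm, hgε⟩ ⟨hgm.sub hsm, hgs.trans ?_⟩
    have : Cp * (C * (ε / 2 / (Cp * C + 1))) ≤ ε / 2 := by
      rw [← mul_assoc, mul_div_assoc', div_le_iff₀ (by positivity), mul_comm]
      exact mul_le_mul_right (le_add_of_nonneg_right zero_le) _
    exact_mod_cast this
  rw [add_halves] at hsum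
  exact hsum.congr (Filter.Eventually.of_forall fun x => by simp only; ring)

end BaseCase

/-! ### Boundedness of the reciprocal impedance -/

section Reciprocal

variable {α β : ℝ} {a : ℝ → ℝ}

/-- Functions with square integrable derivative are Hölder continuous of exponent `1 / 2`. -/
lemma IsPrimitiveOn.norm_sub_sq_le (h : α ≤ β) {B w : ℝ → ℂ} (hB : IsPrimitiveOn α β B w)
    (hw : MemLp w 2 (volume.restrict (Ioo α β))) {x y : ℝ} (hx : x ∈ Icc α β)
    (hy : y ∈ Icc α β) : ‖B y - B x‖ ^ 2 ≤ |y - x| * ∫ t in α..β, ‖w t‖ ^ 2 := by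
  have hw2 : IntervalIntegrable (fun t => ‖w t‖ ^ 2) volume α β :=
    (intervalIntegrable_iff_integrable_Ioo h).2 (hw.integrable_norm_pow two_ne_zero)
  have hsub : Ι x y ⊆ Ι α β := uIoc_subset_uIoc_of_uIcc_subset_uIcc
    (uIcc_subset_uIcc (Icc_subset_uIcc hx) (Icc_subset_uIcc hy))
  have i1 : IntegrableOn (fun t => ‖w t‖) (Ι x y) := (hB.1.norm.def').mono_set hsub
  have i2 : IntegrableOn (fun t => ‖w t‖ ^ 2) (Ι x y) := (hw2.def').mono_set hsub
  have hN : ∫ t in Ι x y, ‖w t‖ ^ 2 ≤ ∫ t in α..β, ‖w t‖ ^ 2 := by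
    rw [intervalIntegral.integral_of_le h, ← uIoc_of_le h]
    exact setIntegral_mono_set hw2.def' (Filter.Eventually.of_forall fun t => by positivity)
      hsub.eventuallyLE
  have hS : ‖B y - B x‖ ≤ ∫ t in Ι x y, ‖w t‖ := by
    rw [← hB.integral_eq hx hy]
    exact intervalIntegral.norm_integral_le_integral_norm_uIoc
  have hS0 : 0 ≤ ∫ t in Ι x y, ‖w t‖ := (norm_nonneg _).trans hS
  -- expand `∫ (‖w‖ - c)² ≥ 0` and take the mean value of `‖w‖` for `c`
  have hq : ∀ c : ℝ, 2 * c * ∫ t in Ι x y, ‖w t‖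
      ≤ (∫ t in Ι x y, ‖w t‖ ^ 2) + c ^ 2 * |y - x| := by
    intro c
    have h0 : 0 ≤ ∫ t in Ι x y, (‖w t‖ - c) ^ 2 := integral_nonneg fun t => sq_nonneg _
    have e : ∀ t, (‖w t‖ - c) ^ 2 = ‖w t‖ ^ 2 - 2 * c * ‖w t‖ + c ^ 2 := fun t => by ring
    have hfin : volume (Ι x y) ≠ ⊤ := by simp [uIoc]
    have ic : IntegrableOn (fun _ : ℝ => c ^ 2) (Ι x y) := integrableOn_const hfin
    simp only [e] at h0
    have i3 : IntegrableOn (fun t => ‖w t‖ ^ 2 - 2 * c * ‖w t‖) (Ι x y) :=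
      i2.sub (i1.const_mul (2 * c))
    rw [integral_add i3 ic, integral_sub i2 (i1.const_mul _),
      integral_const_mul, setIntegral_const, smul_eq_mul] at h0
    have hv : volume.real (Ι x y) = |y - x| := by
      rw [uIoc, Real.volume_real_Ioc_of_le inf_le_sup, max_sub_min_eq_abs]
    rw [hv] at h0
    linarith
  rcases eq_or_ne y x with rfl | hne
  · simp
  · have hpos : 0 < |y - x| := abs_pos.2 (sub_ne_zero.2 hne)
    have h1 := hq ((∫ t in Ι x y, ‖w t‖) / |y - x|)
    have h2 : (∫ t in Ι x y, ‖w t‖) ^ 2 ≤ |y - x| * ∫ t in Ι x y, ‖w t‖ ^ 2 := by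
      have := mul_le_mul_of_nonneg_left h1 hpos.le
      field_simp at this
      nlinarith
    calc ‖B y - B x‖ ^ 2 ≤ (∫ t in Ι x y, ‖w t‖) ^ 2 := by gcongr
      _ ≤ _ := h2.trans (mul_le_mul_of_nonneg_left hN hpos.le)

/-- An impedance with square integrable derivative has no zeros: near a zero, `1 / a ^ 2` would
dominate the reciprocal of the distance. -/
lemma IsProperImpedance.exists_norm_inv_le (h : α < β) (ha : IsProperImpedance α β a)
    {B w : ℝ → ℂ} (hB : IsPrimitiveOn α β B w)
    (hw : MemLp w 2 (volume.restrict (Ioo α β)))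
    (haB : (fun x => (a x : ℂ)) =ᵐ[volume.restrict (Ioo α β)] B) :
    ∃ M : ℝ≥0, ∀ᵐ x ∂volume.restrict (Ioo α β), ‖((a x : ℂ))⁻¹‖ ≤ M := by
  have hne : ∀ x ∈ Icc α β, B x ≠ 0 := by
    intro y hy hy0
    have hN0 : 0 ≤ ∫ t in α..β, ‖w t‖ ^ 2 :=
      intervalIntegral.integral_nonneg h.le fun t _ => by positivity
    set N := ∫ t in α..β, ‖w t‖ ^ 2
    have hi : IntervalIntegrable (fun x => (x - y)⁻¹) volume α β := by
      rw [intervalIntegrable_iff_integrable_Ioo h.le]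
      refine ((intervalIntegrable_iff_integrable_Ioo h.le).1
        ((ha.intervalIntegrable_inv_sq h.le).const_mul (N + 1))).mono'
        (by fun_prop) ?_
      filter_upwards [haB, ha.pos, ae_restrict_mem measurableSet_Ioo] with x hx hpos hxm
      have h1 := hB.norm_sub_sq_le h.le hw hy (Ioo_subset_Icc_self hxm)
      rw [hy0, sub_zero, ← hx, Complex.norm_real, Real.norm_eq_abs, sq_abs] at h1
      rw [norm_inv, Real.norm_eq_abs]
      rcases eq_or_ne x y with rfl | hxy
      · simp only [sub_self, abs_zero, inv_zero]
        positivity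
      · have hd : 0 < |x - y| := abs_pos.2 (sub_ne_zero.2 hxy)
        rw [mul_one_div, le_div_iff₀ (by positivity), inv_mul_le_iff₀ hd]
        nlinarith
    rw [intervalIntegrable_sub_inv_iff] at hi
    rcases hi with hi | hi
    · exact h.ne hi
    · exact hi (Icc_subset_uIcc hy)
  obtain ⟨M, hM⟩ := isCompact_Icc.exists_bound_of_continuousOn (hB.continuousOn.inv₀ hne)
  refine ⟨M.toNNReal, ?_⟩
  filter_upwards [haB, ae_restrict_mem measurableSet_Ioo] with x hx hxm
  rw [hx]
  exact (hM x (Ioo_subset_Icc_self hxm)).trans (Real.le_coe_toNNReal M)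

lemma exists_norm_ofReal_le_of_memLp_top {μ : Measure ℝ} {b : ℝ → ℝ} (hb : MemLp b ⊤ μ) :
    ∃ M : ℝ≥0, ∀ᵐ x ∂μ, ‖(b x : ℂ)‖ ≤ M := by
  refine ⟨(eLpNorm b ⊤ μ).toNNReal, ?_⟩
  have h1 := ae_le_eLpNormEssSup (f := b) (μ := μ)
  rw [← eLpNorm_exponent_top] at h1
  filter_upwards [h1] with x hx
  have h2 := ENNReal.toReal_mono hb.2.ne hx
  rw [toReal_enorm, ← Complex.norm_real] at h2
  exact h2

end Reciprocal

/-! ### Completeness in the Sobolev spaces -/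

theorem mainTheorem2 (α β : ℝ) (hαβ : α < β) (x₀ : ℝ) (hx₀ : x₀ ∈ Icc α β)
    (p : ℝ≥0∞) [Fact (1 ≤ p)] (hp : p ≠ ⊤)
    (a : ℝ → ℝ) (ha : IsProperImpedance α β a) :
    (MemLp a ⊤ (volume.restrict (Ioo α β)) →
      MemLp (fun x => 1 / a x) ⊤ (volume.restrict (Ioo α β)) →
        IsCompleteInSobolev α β 1 p (fun k x => (formalPower a x₀ k x : ℂ))) ∧
    (∀ m : ℕ, 2 ≤ m → MemSobolev α β (m - 1) p a →
      (m = 2 → p < 2 → MemLp (fun x => 1 / a x) ⊤ (volume.restrict (Ioo α β))) →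
        IsCompleteInSobolev α β m p (fun k x => (formalPower a x₀ k x : ℂ))) := by
  have hp1 : 1 ≤ p := Fact.out
  have hme : AEStronglyMeasurable (fun x => (a x : ℂ)) (volume.restrict (Ioo α β)) :=
    ha.memLp.ofReal.1
  have hmi : AEStronglyMeasurable (fun x => (a x : ℂ)⁻¹) (volume.restrict (Ioo α β)) := by
    simpa using ha.memLp_inv.ofReal (K := ℂ).1
  have sq1 : ∀ {q : ℝ≥0∞} {j : ℕ}, IsSobolevMultiplier α β q j (fun x => (a x : ℂ)) →
      IsSobolevMultiplier α β q j (fun x => ((a x ^ 2 : ℝ) : ℂ)) := fun hb => by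
    simpa [sq] using hb.mul hb
  have sq2 : ∀ {q : ℝ≥0∞} {j : ℕ}, IsSobolevMultiplier α β q j (fun x => (a x : ℂ)⁻¹) →
      IsSobolevMultiplier α β q j (fun x => ((1 / a x ^ 2 : ℝ) : ℂ)) := fun hb => by
    simpa [sq] using hb.mul hb
  -- both parts reduce to bounds for `a`, `1 / a` and their multiplier properties
  have main : ∀ (m : ℕ) (K M : ℝ≥0),
      (∀ᵐ x ∂volume.restrict (Ioo α β), ‖(a x : ℂ)‖ ≤ K) →
      (∀ᵐ x ∂volume.restrict (Ioo α β), ‖(a x : ℂ)⁻¹‖ ≤ M) →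
      (∀ j < m, IsSobolevMultiplier α β p j (fun x => (a x : ℂ))) →
      (∀ j < m, IsSobolevMultiplier α β p j (fun x => (a x : ℂ)⁻¹)) →
      IsCompleteInSobolev α β m p (fun k x => (formalPower a x₀ k x : ℂ)) := by
    intro m K M hK hM h1 h2
    have z1 := sq1 (isSobolevMultiplier_zero_of_bound (p := 2) hme hK)
    have z2 := sq2 (isSobolevMultiplier_zero_of_bound (p := 2) hmi hM)
    refine FormalPowersDense.isCompleteInSobolev hαβ
      (exists_sobolevBound_formalPower hαβ.le hx₀ ha m (fun j hj => sq1 (h1 j hj))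
        fun j hj => sq2 (h2 j hj)) ?_
    exact FormalPowersDense.of_zero hαβ.le hx₀ ha m (fun j hj => sq1 (h1 j hj))
      (fun j hj => sq2 (h2 j hj)) (formalPowersDense_zero hp1 hp hαβ hx₀ ha z1 z2)
      (formalPowersDense_zero hp1 hp hαβ hx₀ ha.inv (by simpa using z2) (by simpa using z1))
  refine ⟨fun hb hi => ?_, fun m hm hs hi => ?_⟩
  · obtain ⟨K, hK⟩ := exists_norm_ofReal_le_of_memLp_top hb
    obtain ⟨M, hM⟩ := exists_norm_ofReal_le_of_memLp_top hi
    simp only [one_div, Complex.ofReal_inv] at hM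
    refine main 1 K M hK hM ?_ ?_
    · intro j hj
      obtain rfl : j = 0 := by omega
      exact isSobolevMultiplier_zero_of_bound hme hK
    · intro j hj
      obtain rfl : j = 0 := by omega
      exact isSobolevMultiplier_zero_of_bound hmi hM
  · obtain ⟨n, rfl⟩ : ∃ n, m = n + 2 := ⟨m - 2, by omega⟩
    obtain ⟨K, hK⟩ := hs.ofReal.exists_sobolevBound hp1 hαβ
    rw [show n + 2 - 1 = n + 1 by omega] at hK
    obtain ⟨M, hM⟩ : ∃ M : ℝ≥0, ∀ᵐ x ∂volume.restrict (Ioo α β), ‖(a x : ℂ)⁻¹‖ ≤ M := by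
      by_cases hcase : n = 0 ∧ p < 2
      · obtain ⟨M, hM⟩ := exists_norm_ofReal_le_of_memLp_top (hi (by omega) hcase.2)
        simp only [one_div, Complex.ofReal_inv] at hM
        exact ⟨M, hM⟩
      · obtain ⟨B, w, hB, -, hw, haB⟩ := hK
        refine ha.exists_norm_inv_le hαβ hB ?_ haB
        rcases n with _ | n
        · have hp2 : 2 ≤ p := not_lt.1 fun hlt => hcase ⟨rfl, hlt⟩
          exact MemLp.mono_exponent ⟨hw.1, hw.2.trans_lt ENNReal.coe_lt_top⟩ hp2
        · obtain ⟨C, hC⟩ := SobolevBound.exists_norm_le (p := p) (α := α) (β := β) hp1 hαβ.le n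
          obtain ⟨C', hC'⟩ := SobolevBound.exists_eLpNorm_le (p := p) (α := α) (β := β) hp1
            hαβ.le (n + 1)
          exact MemLp.of_bound (hC' K w hw).1 _ (hC K w hw)
    obtain ⟨C, hC⟩ := SobolevBound.exists_norm_le (p := p) (α := α) (β := β) hp1 hαβ.le n
    obtain ⟨K', hK'⟩ := hK.exists_inv hp1 hαβ n hM (ha.pos.mono fun x hx => by
      exact_mod_cast hx.ne')
    have hmult : ∀ {b : ℝ → ℂ} {L : ℝ≥0}, SobolevBound α β p (n + 1) L b → ∀ j < n + 2,
        IsSobolevMultiplier α β p j b := by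
      intro b L hb j hj
      obtain ⟨C, hC⟩ := SobolevBound.exists_of_le (p := p) (α := α) (β := β) hp1 hαβ.le
        (show max j 1 ≤ n + 1 by omega)
      exact (hC L b hb).isSobolevMultiplier hp1 hαβ.le
    exact main (n + 2) (C * K) M (hC K _ hK) hM (hmult hK) (hmult hK')
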